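/- Write $e(x)=e^{2\pi i x}$ and $e_r(x)=e(x/r)$. For $r,j\in\mathbb N$, real $L,M\ge 1$, complex numbers $\boldsymbol\alpha=(\alpha_l)_{|l|\le L}$ ($l\in\mathbb Z$) and $\boldsymbol\beta=(\beta_m)_{1\le m\le M}$ ($m\in\mathbb N$), and $f:[1,M]\to\mathbb R$, put $$\Sigma(r,j,L,M,\boldsymbol\alpha,\boldsymbol\beta,f)=\sum_{|l|\le L}\ \sum_{1\le m\le M}\ \sum_{\substack{k \bmod r\\ k^2\equiv jm \bmod r}}\alpha_l\beta_m\, e_r(lk)\, e(lf(m)),$$ $$\|\boldsymbol\alpha\|_2=\Big(\sum_{|l|\le L}|\alpha_l|^2\Big)^{1/2},\qquad \|\boldsymbol\beta\|_\infty=\max_{1\le m\le M}|\beta_m|.$$ Theorem. For every $\varepsilon>0$ there is a constant $C=C(\varepsilon)>0$ such that the following holds. Let $r,j\in\mathbb N$ with $(r,j)=1$, let $1\le L,M\le r$, let $f:[1,M]\to\mathbb R$ be continuously differentiable with $|f'(x)|\le F$ on $[1,M]$, where $F\le 1/L$, let $\boldsymbol\alpha,\boldsymbol\beta$ be arbitrary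 complex sequences as above, and let $H\in\mathbb N$ satisfy $1\le H\le\min\{1/(LF),M\}$ (with $1/(LF)=\infty$ if $F=0$). Then $$|\Sigma(r,j,L,M,\boldsymbol\alpha,\boldsymbol\beta,f)|\le C\left(H^{-1/2}L^{1/2}M+H^{1/4}L^{1/4}M+H^{-1/4}L^{1/4}M^{3/4}r^{1/4}\right)\|\boldsymbol\alpha\|_2\|\boldsymbol\beta\|_\infty r^{\varepsilon}.$$ -/

import Mathlib

open scoped NNReal

noncomputable section

/-- The additive character `e(x) = exp(2πix)`. -/
def expChar (x : ℝ) : ℂ := Complex.exp (2 * Real.pi * Complex.I * x)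

/-- The modular square roots of `s` modulo `r`: the residues `0 ≤ k < r` with `k² ≡ s mod r`. -/
def modSqrts (r s : ℕ) : Finset ℕ := (Finset.range r).filter (fun k => k ^ 2 ≡ s [MOD r])

/-- The integers `l` with `|l| ≤ L`. -/
def lRange (L : ℝ) : Finset ℤ := Finset.Icc (-⌊L⌋) ⌊L⌋

/-- The natural numbers `m` with `1 ≤ m ≤ M`. -/
def mRange (M : ℝ) : Finset ℕ := Finset.Icc 1 ⌊M⌋₊

lemma mem_lRange {L : ℝ} {l : ℤ} : l ∈ lRange L ↔ |(l : ℝ)| ≤ L := by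
  rw [lRange, Finset.mem_Icc, neg_le, Int.le_floor, Int.le_floor, abs_le, Int.cast_neg, neg_le,
    and_comm, and_comm]

lemma mem_mRange {M : ℝ} (hM : 0 ≤ M) {m : ℕ} : m ∈ mRange M ↔ 1 ≤ m ∧ (m : ℝ) ≤ M := by
  rw [mRange, Finset.mem_Icc, Nat.le_floor_iff hM]

/-- The bilinear sum `∑_{|l| ≤ L} ∑_{1 ≤ m ≤ M} α_l β_m e_r(l √(jm)) e(l f(m))`, where `√(jm)` runs
over all modular square roots of `jm` modulo `r`. -/
def bilinearSum (r j : ℕ) (L M : ℝ) (α : ℤ → ℂ) (β : ℕ → ℂ) (f : ℝ → ℝ) : ℂ :=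
  ∑ l ∈ lRange L, ∑ m ∈ mRange M, ∑ k ∈ modSqrts r (j * m),
    α l * β m * expChar ((l : ℝ) * (k : ℝ) / (r : ℝ)) * expChar ((l : ℝ) * f (m : ℝ))

/-- `‖α‖₂ = (∑_{|l| ≤ L} |α_l|²)^{1/2}`. -/
def l2Norm (L : ℝ) (α : ℤ → ℂ) : ℝ := Real.sqrt (∑ l ∈ lRange L, ‖α l‖ ^ 2)

/-- `‖β‖_∞ = max_{1 ≤ m ≤ M} |β_m|`. -/
def supNorm (M : ℝ) (β : ℕ → ℂ) : ℝ := (((mRange M).sup (fun m => ‖β m‖₊) : ℝ≥0) : ℝ)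

end

/-! Cauchy–Schwarz in `l` removes `α`, leaving the mean square over `|l| ≤ L` of the sum over points
`(m, k)` with `k² ≡ jm` modulo `r`. Cut `m` into blocks of length `H`, losing a factor of order `M /
H`. Within a block `f` varies by at most `FH ≤ 1/L`, which the `l`-sum cannot resolve, so only `k /
r` up to an error of order `1/L` matters. Bounding the Dirichlet kernel then reduces the mean square
to `L` times the number of pairs of points with `|m₁ - m₂| ≤ H` and `|k₁ - k₂| ≤ A`, where `A` is
about `r / L` (`sum_norm_sq_le_card_closePairs`).

The arithmetic is the bound `M² + H³M²A/r + HMA`, up to `r^ε`, for the square of that number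
(`card_closePairs_sq_le`). Pairs with `k₁ = k₂` are single points. For the others put `g = gcd(k₂ -
k₁, r)`, `k₂ - k₁ = g a` and `q = r / g`. Then `g` divides `m₂ - m₁ = g h`, and `a (k₁ + k₂) ≡ j h`
modulo `q`. With `ν = 2 (m₁ + m₂)`, the identity `2 (k₁² + k₂²) = (k₁ + k₂)² + (k₂ - k₁)²` gives `a²
ν ≡ j h² + const` modulo `q`: for fixed `a` the points `(ν, h)` lie on a parabola modulo `q`.

Restrict `m₁ + m₂` to intervals of length `N` with `4NH² < r`. The vectors `(ν - ν', h² - h'²)` lie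
in a lattice of determinant `q` and are too small to be independent, so they are multiples of one
`(n, u)` (`exists_generator_of_small`). The number of points is limited both by `|n|` and by the
congruence of `h²` modulo `u`. The product of the two limits is averaged over `a`, since a given
`(n, u)` serves few `a` (`sum_card_sq_le`). Cauchy–Schwarz over `a` and the intervals, with `N` as
large as allowed, finishes the count. -/

open Finset

/-! ### Divisor and harmonic bounds -/

/-- The divisor bound: `τ(n) ≪ n ^ ε`. -/
lemma exists_card_divisors_le_rpow (ε : ℝ) (hε : 0 < ε) :
    ∃ C : ℝ, 1 ≤ C ∧ ∀ n : ℕ, n ≠ 0 → (#n.divisors : ℝ) ≤ C * (n : ℝ) ^ ε := by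
  -- Primes `p ≥ P` have `p ^ ε ≥ 2` and cost nothing, because `v + 1 ≤ 2 ^ v`. Each of the at most
  -- `P` smaller primes costs a factor `K`, chosen so that `K ε log 2 ≥ 1`.
  set P : ℕ := ⌈(2 : ℝ) ^ (1 / ε)⌉₊
  set K : ℝ := max 1 (1 / (ε * Real.log 2))
  have hK : 1 ≤ K := le_max_left _ _
  have hlog : 0 < Real.log 2 := Real.log_pos (by norm_num)
  have local_bound : ∀ p v : ℕ, p.Prime →
      ((v + 1 : ℕ) : ℝ) ≤ (if p < P then K else 1) * ((p : ℝ) ^ v) ^ ε := by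
    intro p v hp
    have hp2 : (2 : ℝ) ≤ p := by exact_mod_cast hp.two_le
    have hcomm : ((p : ℝ) ^ v) ^ ε = ((p : ℝ) ^ ε) ^ v := by
      rw [← Real.rpow_natCast, ← Real.rpow_mul (by positivity), mul_comm,
        Real.rpow_mul (by positivity), Real.rpow_natCast]
    split_ifs with h
    · have h1 : (2 : ℝ) ^ (ε * v) ≤ ((p : ℝ) ^ v) ^ ε := by
        rw [hcomm, Real.rpow_mul (by norm_num), Real.rpow_natCast]
        exact pow_le_pow_left₀ (by positivity) (Real.rpow_le_rpow (by norm_num) hp2 hε.le) v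
      have h2 : 1 + ε * Real.log 2 * v ≤ (2 : ℝ) ^ (ε * v) := by
        rw [Real.rpow_def_of_pos (by norm_num)]
        linarith [Real.add_one_le_exp (Real.log 2 * (ε * v))]
      have h3 : (1 : ℝ) ≤ K * (ε * Real.log 2) := by
        have : 1 / (ε * Real.log 2) ≤ K := le_max_right _ _
        rwa [div_le_iff₀ (by positivity)] at this
      calc ((v + 1 : ℕ) : ℝ) = 1 * 1 + 1 * v := by push_cast; ring
        _ ≤ K * 1 + K * (ε * Real.log 2) * v := by gcongr
        _ = K * (1 + ε * Real.log 2 * v) := by ring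
        _ ≤ _ := by gcongr; exact h2.trans h1
    · have h1 : (2 : ℝ) ≤ (p : ℝ) ^ ε := by
        have : (2 : ℝ) ^ (1 / ε) ≤ p := (Nat.le_ceil _).trans (by exact_mod_cast not_lt.mp h)
        calc (2 : ℝ) = ((2 : ℝ) ^ (1 / ε)) ^ ε := by
              rw [← Real.rpow_mul (by norm_num), one_div_mul_cancel hε.ne', Real.rpow_one]
          _ ≤ _ := Real.rpow_le_rpow (by positivity) this hε.le
      rw [one_mul, hcomm]
      calc ((v + 1 : ℕ) : ℝ) ≤ ((2 ^ v : ℕ) : ℝ) := by exact_mod_cast Nat.lt_two_pow_self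
        _ = 2 ^ v := by push_cast; rfl
        _ ≤ _ := pow_le_pow_left₀ (by norm_num) h1 v
  refine ⟨K ^ P, one_le_pow₀ hK, fun n hn => ?_⟩
  have hprod : (n : ℝ) ^ ε = ∏ p ∈ n.primeFactors, ((p : ℝ) ^ n.factorization p) ^ ε := by
    rw [Real.finsetProd_rpow _ _ (fun i _ => by positivity)]
    congr 1
    conv_lhs => rw [← Nat.prod_factorization_pow_eq_self hn]
    rw [Finsupp.prod]
    push_cast
    rfl
  rw [Nat.card_divisors hn, hprod]
  push_cast
  calc ∏ p ∈ n.primeFactors, ((n.factorization p : ℝ) + 1)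
      ≤ ∏ p ∈ n.primeFactors, ((if p < P then K else 1) * ((p : ℝ) ^ n.factorization p) ^ ε) := by
        refine prod_le_prod (fun _ _ => by positivity) fun p hp => ?_
        have := local_bound p (n.factorization p) (Nat.prime_of_mem_primeFactors hp)
        push_cast at this
        exact this
    _ = (∏ p ∈ n.primeFactors, if p < P then K else 1)
          * ∏ p ∈ n.primeFactors, ((p : ℝ) ^ n.factorization p) ^ ε := prod_mul_distrib
    _ ≤ _ := by
        refine mul_le_mul_of_nonneg_right ?_ (prod_nonneg fun _ _ => by positivity)
        rw [prod_ite, prod_const, prod_const_one, mul_one]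
        refine pow_le_pow_right₀ hK ?_
        calc #{p ∈ n.primeFactors | p < P} ≤ #(range P) :=
              card_le_card fun p hp => mem_range.mpr (mem_filter.mp hp).2
          _ = P := card_range P

/-- A single majorant `R ≪ r ^ ε` for the divisor function and the harmonic numbers up to `r ^ 2`. -/
lemma exists_divisor_harmonic_bound (ε : ℝ) (hε : 0 < ε) :
    ∃ C : ℝ, 1 ≤ C ∧ ∀ r : ℕ, 0 < r →
      (∀ n : ℕ, n ≠ 0 → n ≤ r ^ 2 → (#n.divisors : ℝ) ≤ C * (r : ℝ) ^ ε) ∧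
      (∀ n : ℕ, n ≤ r ^ 2 → ∑ i ∈ Icc 1 n, (i : ℝ)⁻¹ ≤ C * (r : ℝ) ^ ε) := by
  obtain ⟨C, hC, h⟩ := exists_card_divisors_le_rpow (ε / 2) (by positivity)
  refine ⟨C + (1 + 2 / ε), by have : 0 < 2 / ε := by positivity
                              linarith, fun r hr => ?_⟩
  have hr1 : (1 : ℝ) ≤ r := by exact_mod_cast hr
  have hpow : ((r : ℝ) ^ 2) ^ (ε / 2) = (r : ℝ) ^ ε := by
    rw [← Real.rpow_natCast, ← Real.rpow_mul (by positivity)]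
    congr 1
    push_cast
    ring
  have hone : 1 ≤ (r : ℝ) ^ ε := Real.one_le_rpow hr1 hε.le
  constructor
  · intro n hn hnr
    calc (#n.divisors : ℝ) ≤ C * (n : ℝ) ^ (ε / 2) := h n hn
      _ ≤ C * ((r : ℝ) ^ 2) ^ (ε / 2) := by
          have : (n : ℝ) ≤ (r : ℝ) ^ 2 := by exact_mod_cast hnr
          gcongr
      _ = C * (r : ℝ) ^ ε := by rw [hpow]
      _ ≤ _ := by
          have : 0 < 2 / ε := by positivity
          gcongr
          linarith
  · intro n hnr
    have h0 : (∑ i ∈ Icc 1 n, (i : ℝ)⁻¹) = ((harmonic n : ℚ) : ℝ) := by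
      rw [harmonic_eq_sum_Icc]
      push_cast
      rfl
    rw [h0]
    have h1 := harmonic_le_one_add_log n
    have h2 : Real.log n ≤ 2 / ε * (r : ℝ) ^ ε := by
      rcases Nat.eq_zero_or_pos n with rfl | hn
      · simp; positivity
      calc Real.log n ≤ (n : ℝ) ^ (ε / 2) / (ε / 2) := Real.log_le_rpow_div (by positivity) (by positivity)
        _ ≤ ((r : ℝ) ^ 2) ^ (ε / 2) / (ε / 2) := by
            have : (n : ℝ) ≤ (r : ℝ) ^ 2 := by exact_mod_cast hnr
            gcongr
        _ = _ := by rw [hpow]; field_simp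
    nlinarith [mul_nonneg (zero_le_one.trans hC) (zero_le_one.trans hone)]

/-! ### Counting solutions of quadratic congruences in intervals -/

/-- Integers of an interval of length `X` that are congruent modulo `d` number at most
`X / d + 1`. -/
lemma card_le_of_pairwise_dvd_sub (T : Finset ℤ) (b : ℤ) (X d : ℕ) (hd : 0 < d)
    (hT : ∀ x ∈ T, b ≤ x ∧ x ≤ b + X) (hdvd : ∀ x ∈ T, ∀ y ∈ T, (d : ℤ) ∣ x - y) :
    (#T : ℝ) ≤ (X : ℝ) / d + 1 := by
  have hd' : (0 : ℤ) < d := by exact_mod_cast hd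
  have hcard : #T ≤ #(Icc (0 : ℤ) ((X / d : ℕ) : ℤ)) := by
    refine card_le_card_of_injOn (fun x => (x - b) / d) (fun x hx => ?_) fun x hx y hy hxy => ?_
    · have := hT x hx
      rw [coe_Icc, Set.mem_Icc]
      push_cast
      exact ⟨Int.ediv_nonneg (by linarith) hd'.le, Int.ediv_le_ediv hd' (by linarith)⟩
    · have hmod : (x - b) % d = (y - b) % d :=
        Int.ModEq.symm ((Int.modEq_iff_dvd).mpr (by simpa using hdvd x hx y hy))
      have h1 := Int.mul_ediv_add_emod (x - b) d
      have h2 := Int.mul_ediv_add_emod (y - b) d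
      simp only at hxy
      rw [hxy, hmod] at h1
      linarith
  have h3 : #(Icc (0 : ℤ) ((X / d : ℕ) : ℤ)) = X / d + 1 := by
    generalize X / d = c
    rw [Int.card_Icc]; omega
  calc (#T : ℝ) ≤ ((X / d + 1 : ℕ) : ℝ) := by exact_mod_cast hcard.trans h3.le
    _ ≤ _ := by push_cast; gcongr; exact Nat.cast_div_le

/-- Integers of an interval of length `X` with congruent squares modulo `q`. -/
lemma card_le_of_dvd_sq_sub_sq (T : Finset ℤ) (b x₀ : ℤ) (X q : ℕ) (hq : 0 < q)
    (hT : ∀ x ∈ T, b ≤ x ∧ x ≤ b + X) (hsq : ∀ x ∈ T, (q : ℤ) ∣ x ^ 2 - x₀ ^ 2) :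
    ∃ g : ℕ, 0 < g ∧ g ^ 2 ∣ q ∧ (g : ℤ) ∣ 2 * x₀ ∧
      (#T : ℝ) ≤ #q.divisors * (1 + X * g / q) := by
  rcases T.eq_empty_or_nonempty with rfl | hne
  · exact ⟨1, one_pos, by simp, by simp, by simp; positivity⟩
  have hdivs : q.divisors.Nonempty := ⟨1, Nat.one_mem_divisors.mpr hq.ne'⟩
  -- Sort by `e = gcd(x - x₀, q)`. With `q = e f`, the cofactor `f` must divide `x + x₀`, so a fibre
  -- lies in one class modulo `lcm(e, f) = q / gcd(e, f)`. Taking the largest fibre costs `τ(q)`,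
  -- and `g = gcd(e, f)`.
  set φ : ℤ → ℕ := fun x => (x - x₀).gcd q
  have hφ : ∀ x ∈ T, φ x ∈ q.divisors := fun x _ =>
    Nat.mem_divisors.mpr ⟨by exact_mod_cast Int.gcd_dvd_right (x - x₀) (q : ℤ), hq.ne'⟩
  obtain ⟨e, he, hmax⟩ := q.divisors.exists_max_image (fun e => #{x ∈ T | φ x = e}) hdivs
  have hTle : #T ≤ #q.divisors * #{x ∈ T | φ x = e} := by
    rw [card_eq_sum_card_fiberwise hφ]
    simpa using sum_le_card_nsmul _ _ _ hmax
  have hfne : {x ∈ T | φ x = e}.Nonempty := by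
    rw [← card_pos]
    have := card_pos.mpr hne
    by_contra h0
    rw [Nat.eq_zero_of_not_pos h0] at hTle
    omega
  obtain ⟨f, hf⟩ := (Nat.mem_divisors.mp he).1
  have he0 : 0 < e := Nat.pos_of_mem_divisors he
  have hf0 : 0 < f := Nat.pos_of_ne_zero (by rintro rfl; simp at hf; omega)
  have hboth : ∀ x ∈ T, φ x = e → (e : ℤ) ∣ x - x₀ ∧ (f : ℤ) ∣ x + x₀ := by
    intro x hx hxe
    have h1 : (e : ℤ) ∣ x - x₀ := hxe ▸ Int.gcd_dvd_left (x - x₀) (q : ℤ)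
    refine ⟨h1, ?_⟩
    obtain ⟨t, ht⟩ := h1
    have hcop : IsCoprime t (f : ℤ) := by
      rw [Int.isCoprime_iff_gcd_eq_one]
      have : (x - x₀).gcd q = e * t.gcd f := by
        rw [ht, hf]; push_cast
        rw [Int.gcd_mul_left]; simp
      have h2 : e * t.gcd f = e * 1 := by rw [← this, mul_one]; exact hxe
      exact Nat.eq_of_mul_eq_mul_left he0 h2
    have h3 : (q : ℤ) ∣ e * (t * (x + x₀)) := by
      have := hsq x hx
      rwa [show x ^ 2 - x₀ ^ 2 = (x - x₀) * (x + x₀) by ring, ht, mul_assoc] at this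
    rw [hf] at h3
    push_cast at h3
    exact hcop.symm.dvd_of_dvd_mul_left
      ((mul_dvd_mul_iff_left (by exact_mod_cast he0.ne' : (e : ℤ) ≠ 0)).mp h3)
  refine ⟨e.gcd f, Nat.gcd_pos_of_pos_left _ he0, ?_, ?_, ?_⟩
  · rw [hf, sq]
    exact mul_dvd_mul (Nat.gcd_dvd_left _ _) (Nat.gcd_dvd_right _ _)
  · obtain ⟨x, hx⟩ := hfne
    rw [mem_filter] at hx
    obtain ⟨h1, h2⟩ := hboth x hx.1 hx.2
    have h3 : ((e.gcd f : ℕ) : ℤ) ∣ x - x₀ :=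
      (Int.natCast_dvd_natCast.mpr (Nat.gcd_dvd_left e f)).trans h1
    have h4 : ((e.gcd f : ℕ) : ℤ) ∣ x + x₀ :=
      (Int.natCast_dvd_natCast.mpr (Nat.gcd_dvd_right e f)).trans h2
    have := dvd_sub h4 h3
    rwa [show x + x₀ - (x - x₀) = 2 * x₀ by ring] at this
  · have hl0 : 0 < e.lcm f := Nat.lcm_pos he0 hf0
    have hfib : (#{x ∈ T | φ x = e} : ℝ) ≤ (X : ℝ) / (e.lcm f : ℕ) + 1 := by
      refine card_le_of_pairwise_dvd_sub _ b X _ hl0 (fun x hx => hT x (mem_filter.mp hx).1) ?_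
      intro x hx y hy
      rw [mem_filter] at hx hy
      obtain ⟨h1, h2⟩ := hboth x hx.1 hx.2
      obtain ⟨h3, h4⟩ := hboth y hy.1 hy.2
      rw [Int.natCast_dvd]
      refine Nat.lcm_dvd (Int.natCast_dvd.mp ?_) (Int.natCast_dvd.mp ?_)
      · have := dvd_sub h1 h3
        rwa [show x - x₀ - (y - x₀) = x - y by ring] at this
      · have := dvd_sub h2 h4
        rwa [show x + x₀ - (y + x₀) = x - y by ring] at this
    have hlg : (q : ℝ) = (e.gcd f : ℕ) * (e.lcm f : ℕ) := by
      rw [hf]; exact_mod_cast (Nat.gcd_mul_lcm e f).symm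
    have hg0 : (0 : ℝ) < (e.gcd f : ℕ) := by exact_mod_cast Nat.gcd_pos_of_pos_left _ he0
    have hl0' : (0 : ℝ) < (e.lcm f : ℕ) := by exact_mod_cast hl0
    calc (#T : ℝ) ≤ #q.divisors * #{x ∈ T | φ x = e} := by exact_mod_cast hTle
      _ ≤ #q.divisors * ((X : ℝ) / (e.lcm f : ℕ) + 1) := by gcongr
      _ = _ := by rw [hlg]; field_simp; ring

/-- The units `a` modulo `q`, `|a| ≤ q`, with `a² n ≡ j u` modulo `q`. -/
lemma card_le_of_sq_mul_modEq (S : Finset ℤ) (q : ℕ) (hq : 0 < q) (j n u : ℤ) (R : ℝ)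
    (hR : ∀ d : ℕ, d ≠ 0 → d ≤ q → (#d.divisors : ℝ) ≤ R)
    (hS : ∀ a ∈ S, |a| ≤ q ∧ IsCoprime a (q : ℤ))
    (hn : ∀ a ∈ S, (q : ℤ) ∣ a ^ 2 * n - j * u) :
    (#S : ℝ) ≤ 5 * R * (n.gcd q : ℕ) := by
  have hR1 : 1 ≤ R := by simpa using hR 1 one_ne_zero hq
  have he0 : 0 < n.gcd q := Int.gcd_pos_of_ne_zero_right _ (by exact_mod_cast hq.ne')
  rcases S.eq_empty_or_nonempty with rfl | ⟨a₀, ha₀⟩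
  · simp; positivity
  obtain ⟨q₁, hq₁⟩ : n.gcd q ∣ q := by exact_mod_cast Int.gcd_dvd_right n (q : ℤ)
  obtain ⟨n₁, hn₁⟩ : ((n.gcd q : ℕ) : ℤ) ∣ n := Int.gcd_dvd_left n (q : ℤ)
  set e := n.gcd q with he
  have hq₁0 : 0 < q₁ := Nat.pos_of_ne_zero (by rintro rfl; simp at hq₁; omega)
  have hcop : IsCoprime n₁ (q₁ : ℤ) := by
    rw [Int.isCoprime_iff_gcd_eq_one]
    have h1 : n.gcd q = e * n₁.gcd q₁ := by
      conv_lhs => rw [hn₁, hq₁]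
      push_cast
      rw [Int.gcd_mul_left]; simp
    exact (Nat.eq_of_mul_eq_mul_left he0 ((mul_one e).trans h1)).symm
  have hq₁q : (q₁ : ℤ) ∣ q := Int.natCast_dvd_natCast.mpr ⟨e, by rw [hq₁, mul_comm]⟩
  -- Subtracting two of the congruences and cancelling `e = gcd(n, q)` fixes `a²` modulo `q₁ = q /
  -- e`.
  obtain ⟨g, hg0, hgq, hg2, hcard⟩ := card_le_of_dvd_sq_sub_sq S (-q) a₀ (2 * q) q₁ hq₁0
    (fun x hx => by
      have := abs_le.mp (hS x hx).1
      push_cast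
      constructor <;> linarith)
    (fun x hx => by
      have h1 := dvd_sub (hn x hx) (hn a₀ ha₀)
      rw [show x ^ 2 * n - j * u - (a₀ ^ 2 * n - j * u) = n * (x ^ 2 - a₀ ^ 2) by ring,
        hn₁, hq₁] at h1
      push_cast at h1
      rw [mul_assoc] at h1
      exact hcop.symm.dvd_of_dvd_mul_left
        ((mul_dvd_mul_iff_left (by exact_mod_cast he0.ne' : (e : ℤ) ≠ 0)).mp h1))
  -- `g` divides both `q` and `2 a₀`, and `a₀` is a unit modulo `q`.
  have hg : g ≤ 2 := by
    have hgq' : (g : ℤ) ∣ q := (Int.natCast_dvd_natCast.mpr ((dvd_pow_self g two_ne_zero).trans hgq)).trans hq₁q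
    have hc : IsCoprime (g : ℤ) a₀ := ((hS a₀ ha₀).2.of_isCoprime_of_dvd_right hgq').symm
    exact Nat.le_of_dvd two_pos (by exact_mod_cast hc.dvd_of_dvd_mul_right hg2)
  have hq₁q' : q₁ ≤ q := by exact_mod_cast Int.le_of_dvd (by exact_mod_cast hq) hq₁q
  have hg' : (g : ℝ) ≤ 2 := by exact_mod_cast hg
  have hq₁' : (0 : ℝ) < q₁ := by exact_mod_cast hq₁0
  have he1 : (1 : ℝ) ≤ e := by exact_mod_cast he0
  calc (#S : ℝ) ≤ #q₁.divisors * (1 + (2 * q : ℕ) * g / q₁) := hcard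
    _ ≤ R * (1 + (2 * q : ℕ) * 2 / q₁) := by
        gcongr
        exact hR q₁ hq₁0.ne' hq₁q'
    _ = R * (1 + 4 * e) := by
        have : (q : ℝ) = e * q₁ := by exact_mod_cast hq₁
        push_cast
        rw [this]; field_simp; ring
    _ ≤ R * (5 * e) := by gcongr; linarith
    _ = _ := by ring

/-! ### Points on a parabola modulo `q` in a small box -/

/-- If all the difference vectors `(ν h - ν h₀, h² - h₀²)` lie in a lattice of large determinant,
they are multiples of one vector `(n, u)` of the lattice. -/
lemma exists_generator_of_small (T : Finset ℤ) (ν : ℤ → ℤ) (q Y X : ℕ) (j a h₀ h₁ : ℤ)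
    (hj : IsCoprime j (q : ℤ)) (hX : 1 ≤ X) (hsmall : 2 * X * Y ^ 2 < q)
    (hT : ∀ h ∈ T, |h| ≤ Y) (hν : ∀ h ∈ T, |ν h - ν h₀| ≤ X)
    (hrel : ∀ h ∈ T, (q : ℤ) ∣ a ^ 2 * (ν h - ν h₀) - j * (h ^ 2 - h₀ ^ 2))
    (hh₀ : h₀ ∈ T) (hh₁ : h₁ ∈ T) (hne : h₁ ^ 2 ≠ h₀ ^ 2) :
    ∃ (n : ℤ) (u : ℕ), n ≠ 0 ∧ 0 < u ∧ |n| ≤ X ∧ u ≤ Y ^ 2 ∧ (q : ℤ) ∣ a ^ 2 * n - j * u ∧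
      (∀ h ∈ T, (u : ℤ) ∣ h ^ 2 - h₀ ^ 2) ∧ (#T : ℝ) * |(n : ℝ)| ≤ 6 * X := by
  have hXY : (2 * X * Y ^ 2 : ℤ) < q := by exact_mod_cast hsmall
  have hX1 : (1 : ℤ) ≤ X := by exact_mod_cast hX
  have husmall : ∀ h ∈ T, |h ^ 2 - h₀ ^ 2| ≤ (Y : ℤ) ^ 2 := by
    intro h hh
    have h1 : h ^ 2 ≤ (Y : ℤ) ^ 2 := sq_le_sq' (abs_le.mp (hT h hh)).1 (abs_le.mp (hT h hh)).2
    have h2 : h₀ ^ 2 ≤ (Y : ℤ) ^ 2 :=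
      sq_le_sq' (abs_le.mp (hT h₀ hh₀)).1 (abs_le.mp (hT h₀ hh₀)).2
    rw [abs_le]
    constructor <;> nlinarith [sq_nonneg h, sq_nonneg h₀]
  have hu1 : h₁ ^ 2 - h₀ ^ 2 ≠ 0 := sub_ne_zero.mpr hne
  set n₁ := ν h₁ - ν h₀
  set u₁ := h₁ ^ 2 - h₀ ^ 2
  have hn1 : n₁ ≠ 0 := by
    intro h0
    have h1 := hrel h₁ hh₁
    rw [show ν h₁ - ν h₀ = 0 from h0, mul_zero, zero_sub, dvd_neg] at h1
    have h2 := hj.symm.dvd_of_dvd_mul_left h1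
    have h3 := Int.le_of_dvd (abs_pos.mpr hu1) ((dvd_abs _ _).mpr h2)
    nlinarith [husmall h₁ hh₁, sq_nonneg (Y : ℤ)]
  -- Eliminating `a²` shows that `q` divides `j` times the determinant of two difference vectors.
  -- That determinant is at most `2XY² < q` in absolute value, so it vanishes.
  have hcol : ∀ h ∈ T, (ν h - ν h₀) * u₁ = n₁ * (h ^ 2 - h₀ ^ 2) := by
    intro h hh
    have h1 : (q : ℤ) ∣ j * ((ν h - ν h₀) * u₁ - n₁ * (h ^ 2 - h₀ ^ 2)) := by
      obtain ⟨c, hc⟩ := hrel h hh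
      obtain ⟨d, hd⟩ := hrel h₁ hh₁
      exact ⟨n₁ * c - (ν h - ν h₀) * d, by linear_combination n₁ * hc - (ν h - ν h₀) * hd⟩
    have h2 := hj.symm.dvd_of_dvd_mul_left h1
    have h3 : |(ν h - ν h₀) * u₁ - n₁ * (h ^ 2 - h₀ ^ 2)| < q := by
      calc _ ≤ |(ν h - ν h₀) * u₁| + |n₁ * (h ^ 2 - h₀ ^ 2)| := abs_sub _ _
        _ = |ν h - ν h₀| * |u₁| + |n₁| * |h ^ 2 - h₀ ^ 2| := by rw [abs_mul, abs_mul]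
        _ ≤ X * (Y : ℤ) ^ 2 + X * (Y : ℤ) ^ 2 := by
            gcongr
            exacts [hν h hh, husmall h₁ hh₁, hν h₁ hh₁, husmall h hh]
        _ < q := by linarith
    exact sub_eq_zero.mp (Int.eq_zero_of_abs_lt_dvd h2 h3)
  -- Second coordinates of the lattice vectors on the line through `(n₁, u₁)`. As `u₁ ≠ 0`, the
  -- second coordinate determines the vector, so a generator of this cyclic group gives `(n, u)`.
  let G : AddSubgroup ℤ :=
    { carrier := {u | ∃ n, (q : ℤ) ∣ a ^ 2 * n - j * u ∧ n * u₁ = n₁ * u}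
      add_mem' := by
        rintro x y ⟨n, ⟨c, h1⟩, h2⟩ ⟨m, ⟨d, h3⟩, h4⟩
        exact ⟨n + m, ⟨c + d, by linear_combination h1 + h3⟩, by linear_combination h2 + h4⟩
      zero_mem' := ⟨0, by simp, by simp⟩
      neg_mem' := by
        rintro x ⟨n, ⟨c, h1⟩, h2⟩
        exact ⟨-n, ⟨-c, by linear_combination -h1⟩, by linear_combination -h2⟩ }
  have hG : ∀ h ∈ T, h ^ 2 - h₀ ^ 2 ∈ G := fun h hh => ⟨ν h - ν h₀, hrel h hh, hcol h hh⟩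
  obtain ⟨u, huG, hudvd⟩ : ∃ u : ℕ, (u : ℤ) ∈ G ∧ ∀ x ∈ G, (u : ℤ) ∣ x := by
    obtain ⟨c, hc⟩ := Int.subgroup_cyclic G
    have hcG : c ∈ G := hc ▸ AddSubgroup.mem_closure_singleton_self c
    refine ⟨c.natAbs, ?_, fun x hx => ?_⟩
    · rcases Int.natAbs_eq c with h | h
      · rwa [← h]
      · rw [show (c.natAbs : ℤ) = -c by omega]
        exact G.neg_mem hcG
    · rw [hc, AddSubgroup.mem_closure_singleton] at hx
      obtain ⟨k, rfl⟩ := hx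
      rw [Int.natAbs_dvd, smul_eq_mul]
      exact dvd_mul_left c k
  obtain ⟨n, hnq, hnu⟩ := huG
  have hu0 : u ≠ 0 := by
    rintro rfl
    exact hu1 (by simpa using hudvd _ (hG h₁ hh₁))
  have hn0 : n ≠ 0 := by
    rintro rfl
    rw [zero_mul] at hnu
    exact mul_ne_zero hn1 (by exact_mod_cast hu0) hnu.symm
  have hmult : ∀ h ∈ T, ∃ t : ℤ, h ^ 2 - h₀ ^ 2 = u * t ∧ ν h - ν h₀ = n * t := by
    intro h hh
    obtain ⟨t, ht⟩ := hudvd _ (hG h hh)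
    refine ⟨t, ht, ?_⟩
    have h1 := hcol h hh
    rw [ht] at h1
    exact mul_right_cancel₀ hu1 (by linear_combination h1 - t * hnu)
  have hupos : (0 : ℤ) < u := by exact_mod_cast Nat.pos_of_ne_zero hu0
  have hnpos : 0 < |n| := abs_pos.mpr hn0
  have hnX : |n| ≤ X := by
    obtain ⟨t, -, ht⟩ := hmult h₁ hh₁
    have htpos : 1 ≤ |t| := abs_pos.mpr fun (h0 : t = 0) => hn1 (by rw [show n₁ = n * t from ht, h0, mul_zero])
    calc |n| ≤ |n| * |t| := le_mul_of_one_le_right hnpos.le htpos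
      _ = |ν h₁ - ν h₀| := by rw [ht, abs_mul]
      _ ≤ X := hν h₁ hh₁
  refine ⟨n, u, hn0, Nat.pos_of_ne_zero hu0, hnX, ?_, hnq, fun h hh => hudvd _ (hG h hh), ?_⟩
  · have h1 := Int.le_of_dvd (abs_pos.mpr hu1) ((dvd_abs _ _).mpr (hudvd _ (hG h₁ hh₁)))
    exact_mod_cast h1.trans (husmall h₁ hh₁)
  -- The multipliers lie in `[-t, t]` and each comes only from some `±h`. Since `t ≥ 1`, this gives
  -- `2 (2t + 1) ≤ 6t`.
  · set t : ℤ := X / |n|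
    have ht1 : 1 ≤ t := (Int.le_ediv_iff_mul_le hnpos).mpr (by linarith)
    have himg : T.image (fun h => (h ^ 2 - h₀ ^ 2) / (u : ℤ)) ⊆ Icc (-t) t := by
      intro y hy
      obtain ⟨h, hh, rfl⟩ := mem_image.mp hy
      obtain ⟨s, hs1, hs2⟩ := hmult h hh
      rw [hs1, Int.mul_ediv_cancel_left _ hupos.ne', mem_Icc, ← abs_le,
        Int.le_ediv_iff_mul_le hnpos, mul_comm, ← abs_mul, ← hs2]
      exact hν h hh
    have hfib : #T ≤ 2 * #(T.image (fun h => (h ^ 2 - h₀ ^ 2) / (u : ℤ))) := by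
      refine card_le_mul_card_image T 2 fun y hy => ?_
      obtain ⟨h, hh, hhy⟩ := mem_image.mp hy
      refine (card_le_card (t := {h, -h}) fun x hx => ?_).trans card_le_two
      obtain ⟨hx1, hx2⟩ := mem_filter.mp hx
      have hxy := hx2.trans hhy.symm
      obtain ⟨s, hs, -⟩ := hmult h hh
      obtain ⟨s', hs', -⟩ := hmult x hx1
      simp only [hs, hs', Int.mul_ediv_cancel_left _ hupos.ne'] at hxy
      have : x ^ 2 = h ^ 2 := by rw [hxy] at hs'; linarith
      rw [mem_insert, mem_singleton]
      exact sq_eq_sq_iff_eq_or_eq_neg.mp this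
    have hcard : (#T : ℤ) ≤ 6 * t := by
      have h1 : #(Icc (-t) t) = (2 * t + 1).toNat := by rw [Int.card_Icc]; congr 1; ring
      have h2 := card_le_card himg
      omega
    have hle : (#T : ℤ) * |n| ≤ 6 * X := by
      calc (#T : ℤ) * |n| ≤ 6 * t * |n| := by gcongr
        _ = 6 * (X / |n| * |n|) := by ring
        _ ≤ 6 * X := by
            have := Int.ediv_mul_le (X : ℤ) hnpos.ne'
            linarith
    exact_mod_cast hle

/-- `∑_{n ≤ X} gcd(n, q) / n` is at most `τ(q)` times a harmonic number. -/
lemma sum_gcd_div_le (q X : ℕ) (hq : 0 < q) :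
    ∑ n ∈ Icc 1 X, (n.gcd q : ℝ) / n ≤ #q.divisors * ∑ n ∈ Icc 1 X, (n : ℝ)⁻¹ := by
  -- Enlarge `gcd(n, q)` to the sum of all `e ∣ q` that divide `n`. Each `e` then contributes a
  -- harmonic sum over `n / e`.
  have h1 : ∀ n ∈ Icc 1 X, (n.gcd q : ℝ) / n ≤
      ∑ e ∈ q.divisors, if e ∣ n then (e : ℝ) / n else 0 := by
    intro n _
    have hmem : n.gcd q ∈ q.divisors := Nat.mem_divisors.mpr ⟨Nat.gcd_dvd_right _ _, hq.ne'⟩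
    refine le_trans ?_ (single_le_sum (fun e _ => ?_) hmem)
    · rw [if_pos (Nat.gcd_dvd_left n q)]
    · split_ifs <;> positivity
  refine (sum_le_sum h1).trans ?_
  rw [sum_comm, ← nsmul_eq_mul]
  refine sum_le_card_nsmul _ _ _ fun e he => ?_
  have he0 : 0 < e := Nat.pos_of_mem_divisors he
  rw [← sum_filter]
  have h2 : ∀ n ∈ {n ∈ Icc 1 X | e ∣ n}, (e : ℝ) / n = ((n / e : ℕ) : ℝ)⁻¹ := by
    intro n hn
    obtain ⟨m, rfl⟩ := (mem_filter.mp hn).2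
    rw [Nat.mul_div_cancel_left _ he0]
    push_cast
    have : (0 : ℝ) < e := by exact_mod_cast he0
    field_simp
  rw [sum_congr rfl h2, ← sum_image (f := fun m : ℕ => (m : ℝ)⁻¹) (g := fun n => n / e)]
  · refine sum_le_sum_of_subset_of_nonneg (fun m hm => ?_) fun _ _ _ => by positivity
    obtain ⟨n, hn, rfl⟩ := mem_image.mp hm
    obtain ⟨hn1, k, rfl⟩ := mem_filter.mp hn
    rw [Nat.mul_div_cancel_left _ he0]
    rw [mem_Icc] at hn1 ⊢
    refine ⟨Nat.pos_of_ne_zero (by rintro rfl; simp at hn1), ?_⟩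
    exact (Nat.le_mul_of_pos_left k he0).trans hn1.2
  · intro n hn m hm hnm
    obtain ⟨-, k, rfl⟩ := mem_filter.mp (mem_coe.mp hn)
    obtain ⟨-, l, rfl⟩ := mem_filter.mp (mem_coe.mp hm)
    simp only [Nat.mul_div_cancel_left _ he0] at hnm
    rw [hnm]

/-- Two bounds for `#T` are multiplied. Let `(n, u)` be the generator: `#T ≪ X / |n|` by spacing,
while congruent squares modulo `u = g² v` give `#T ≪ R Y / (g v)`. The generator depends on `a`, so
its contribution is enlarged to a sum over all possible (sign, `|n|`, `g`, `v`), which can later be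
exchanged with the sum over `a`. The term `4R²` covers `#T ≤ 2R`. -/
lemma card_sq_le_of_sq_relation (T : Finset ℤ) (ν : ℤ → ℤ) (q Y X B : ℕ) (j a : ℤ) (R : ℝ)
    (hj : IsCoprime j (q : ℤ)) (hX : 1 ≤ X) (hsmall : 2 * X * Y ^ 2 < q)
    (hR : ∀ d : ℕ, d ≠ 0 → d ≤ B → (#d.divisors : ℝ) ≤ R) (hYB : Y ^ 2 ≤ B) (hB : 0 < B)
    (hT : ∀ h ∈ T, |h| ≤ Y) (hν : ∀ h ∈ T, ∀ h' ∈ T, |ν h - ν h'| ≤ X)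
    (hrel : ∀ h ∈ T, ∀ h' ∈ T, (q : ℤ) ∣ a ^ 2 * (ν h - ν h') - j * (h ^ 2 - h' ^ 2)) :
    (#T : ℝ) ^ 2 ≤ 4 * R ^ 2 + 24 * R * X * Y *
      ∑ p ∈ ({1, -1} : Finset ℤ) ×ˢ Icc 1 X ×ˢ Icc 1 Y ×ˢ Icc 1 (Y ^ 2),
        if (q : ℤ) ∣ a ^ 2 * (p.1 * p.2.1) - j * (p.2.2.1 ^ 2 * p.2.2.2 : ℕ) then
          (p.2.1 : ℝ)⁻¹ * ((p.2.2.1 : ℝ)⁻¹ * (p.2.2.2 : ℝ)⁻¹) else 0 := by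
  have hR1 : 1 ≤ R := by simpa using hR 1 one_ne_zero hB
  have hnonneg : ∀ p ∈ ({1, -1} : Finset ℤ) ×ˢ Icc 1 X ×ˢ Icc 1 Y ×ˢ Icc 1 (Y ^ 2),
      (0 : ℝ) ≤ if (q : ℤ) ∣ a ^ 2 * (p.1 * p.2.1) - j * (p.2.2.1 ^ 2 * p.2.2.2 : ℕ) then
          (p.2.1 : ℝ)⁻¹ * ((p.2.2.1 : ℝ)⁻¹ * (p.2.2.2 : ℝ)⁻¹) else 0 := by
    intro p _
    split_ifs <;> positivity
  by_cases hsm : (#T : ℝ) ≤ 2 * R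
  · have h1 := sum_nonneg hnonneg
    have h2 : (#T : ℝ) ^ 2 ≤ (2 * R) ^ 2 := by gcongr
    have h3 : 0 ≤ 24 * R * X * Y := by positivity
    nlinarith [mul_nonneg h3 h1]
  push Not at hsm
  have hTne : T.Nonempty := by
    rw [← card_pos]
    have : (0 : ℝ) < #T := by linarith
    exact_mod_cast this
  obtain ⟨h₀, hh₀⟩ := hTne
  obtain ⟨h₁, hh₁, hne⟩ : ∃ h₁ ∈ T, h₁ ^ 2 ≠ h₀ ^ 2 := by
    by_contra! hall
    have hsub : T ⊆ {h₀, -h₀} := fun x hx => by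
      rw [mem_insert, mem_singleton]
      exact sq_eq_sq_iff_eq_or_eq_neg.mp (hall x hx)
    have : (#T : ℝ) ≤ 2 := by exact_mod_cast (card_le_card hsub).trans card_le_two
    linarith
  obtain ⟨n, u, hn0, hu0, hnX, huY, hrel', hdvd, hcard⟩ := exists_generator_of_small T ν q Y X j a
    h₀ h₁ hj hX hsmall hT (fun h hh => hν h hh h₀ hh₀) (fun h hh => hrel h hh h₀ hh₀) hh₀ hh₁ hne
  obtain ⟨g, hg0, hgu, -, hcard'⟩ := card_le_of_dvd_sq_sub_sq T (-Y) h₀ (2 * Y) u hu0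
    (fun x hx => by
      have := abs_le.mp (hT x hx)
      push_cast
      constructor <;> linarith) hdvd
  obtain ⟨v, rfl⟩ := hgu
  have hv0 : 0 < v := Nat.pos_of_ne_zero (by rintro rfl; simp at hu0)
  have hgY : g ≤ Y := by
    have : g ^ 2 ≤ Y ^ 2 := (Nat.le_mul_of_pos_right _ hv0).trans huY
    exact (Nat.pow_le_pow_iff_left two_ne_zero).mp this
  have hvY : v ≤ Y ^ 2 := (Nat.le_mul_of_pos_left _ (by positivity)).trans huY
  have hnabs : n = n.sign * n.natAbs := (Int.sign_mul_natAbs n).symm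
  have hsign : n.sign ∈ ({1, -1} : Finset ℤ) := by
    rcases lt_or_gt_of_ne hn0 with h | h
    · simp [Int.sign_eq_neg_one_of_neg h]
    · simp [Int.sign_eq_one_of_pos h]
  have hmem : (n.sign, n.natAbs, g, v) ∈
      ({1, -1} : Finset ℤ) ×ˢ Icc 1 X ×ˢ Icc 1 Y ×ˢ Icc 1 (Y ^ 2) := by
    simp only [mem_product, mem_Icc]
    refine ⟨hsign, ⟨Int.natAbs_pos.mpr hn0, by exact_mod_cast (Int.natCast_natAbs n).trans_le hnX⟩, ⟨hg0, hgY⟩, hv0, hvY⟩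
  have hsingle := single_le_sum hnonneg hmem
  simp only [← hnabs] at hsingle
  rw [if_pos hrel'] at hsingle
  have hnR : (0 : ℝ) < n.natAbs := by exact_mod_cast Int.natAbs_pos.mpr hn0
  have hgR : (0 : ℝ) < g := by exact_mod_cast hg0
  have hvR : (0 : ℝ) < v := by exact_mod_cast hv0
  have hc1 : (#T : ℝ) ≤ 6 * X * (n.natAbs : ℝ)⁻¹ := by
    rw [← div_eq_mul_inv, le_div_iff₀ hnR]
    rwa [Nat.cast_natAbs, Int.cast_abs]
  have hc2 : (#T : ℝ) ≤ 4 * R * Y * ((g : ℝ)⁻¹ * (v : ℝ)⁻¹) := by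
    have h1 : (#T : ℝ) ≤ R * (1 + 2 * (Y * ((g : ℝ)⁻¹ * (v : ℝ)⁻¹))) := by
      refine hcard'.trans ?_
      have heq : ((2 * Y : ℕ) : ℝ) * g / (g ^ 2 * v : ℕ) = 2 * (Y * ((g : ℝ)⁻¹ * (v : ℝ)⁻¹)) := by
        push_cast
        rw [div_eq_iff (by positivity)]
        calc 2 * (Y : ℝ) * g = 2 * (Y * ((g : ℝ)⁻¹ * g * ((v : ℝ)⁻¹ * v))) * g := by
              rw [inv_mul_cancel₀ hgR.ne', inv_mul_cancel₀ hvR.ne']; ring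
          _ = _ := by ring
      rw [heq]
      gcongr
      exact hR _ hu0.ne' (huY.trans hYB)
    -- `#T > 2R` absorbs the summand `R`, at the price of doubling the constant.
    linarith
  calc (#T : ℝ) ^ 2 = #T * #T := sq _
    _ ≤ (6 * X * (n.natAbs : ℝ)⁻¹) * (4 * R * Y * ((g : ℝ)⁻¹ * (v : ℝ)⁻¹)) := 
        mul_le_mul hc1 hc2 (Nat.cast_nonneg _) (by positivity)
    _ = 24 * R * X * Y * ((n.natAbs : ℝ)⁻¹ * ((g : ℝ)⁻¹ * (v : ℝ)⁻¹)) := by ring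
    _ ≤ _ := by
        refine (mul_le_mul_of_nonneg_left hsingle (by positivity)).trans ?_
        have : 0 ≤ 4 * R ^ 2 := by positivity
        linarith

/-- Second moment over units `a` modulo `q` of the number of points on the parabola
`a² ν ≡ j h² + const` in a small box. -/
lemma sum_card_sq_le (S : Finset ℤ) (T : ℤ → Finset ℤ) (ν : ℤ → ℤ → ℤ) (q Y X B : ℕ) (j : ℤ) (R : ℝ)
    (hq : 0 < q) (hj : IsCoprime j (q : ℤ)) (hX : 1 ≤ X) (hsmall : 2 * X * Y ^ 2 < q)
    (hR : ∀ d : ℕ, d ≠ 0 → d ≤ B → (#d.divisors : ℝ) ≤ R)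
    (hharm : ∀ n : ℕ, n ≤ B → ∑ i ∈ Icc 1 n, (i : ℝ)⁻¹ ≤ R)
    (hqB : q ≤ B) (hYB : Y ^ 2 ≤ B) (hXB : X ≤ B)
    (hS : ∀ a ∈ S, |a| ≤ q ∧ IsCoprime a (q : ℤ))
    (hT : ∀ a ∈ S, ∀ h ∈ T a, |h| ≤ Y)
    (hν : ∀ a ∈ S, ∀ h ∈ T a, ∀ h' ∈ T a, |ν a h - ν a h'| ≤ X)
    (hrel : ∀ a ∈ S, ∀ h ∈ T a, ∀ h' ∈ T a,
      (q : ℤ) ∣ a ^ 2 * (ν a h - ν a h') - j * (h ^ 2 - h' ^ 2)) :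
    ∑ a ∈ S, (#(T a) : ℝ) ^ 2 ≤ 4 * R ^ 2 * #S + 240 * R ^ 6 * (X * Y) := by
  have hR1 : 1 ≤ R := by simpa using hR 1 one_ne_zero (hq.trans_le hqB)
  have hRY : ∑ i ∈ Icc 1 Y, (i : ℝ)⁻¹ ≤ R :=
    hharm Y ((Nat.le_self_pow two_ne_zero Y).trans hYB)
  refine (sum_le_sum fun a ha => card_sq_le_of_sq_relation (T a) (ν a) q Y X B j a R hj hX hsmall
    hR hYB (hq.trans_le hqB) (hT a ha) (hν a ha) (hrel a ha)).trans ?_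
  rw [sum_add_distrib, sum_const, nsmul_eq_mul, ← mul_sum, sum_comm, mul_comm (#S : ℝ)]
  refine add_le_add_right ?_ _
  -- For fixed `(σ, n, g, v)` only `O(R gcd(n, q))` units `a` satisfy the congruence.
  have hinner : ∀ p ∈ ({1, -1} : Finset ℤ) ×ˢ Icc 1 X ×ˢ Icc 1 Y ×ˢ Icc 1 (Y ^ 2),
      (∑ a ∈ S, if (q : ℤ) ∣ a ^ 2 * (p.1 * p.2.1) - j * (p.2.2.1 ^ 2 * p.2.2.2 : ℕ) then
          (p.2.1 : ℝ)⁻¹ * ((p.2.2.1 : ℝ)⁻¹ * (p.2.2.2 : ℝ)⁻¹) else 0) ≤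
        5 * R * (((p.2.1.gcd q : ℕ) : ℝ) / p.2.1 * ((p.2.2.1 : ℝ)⁻¹ * (p.2.2.2 : ℝ)⁻¹)) := by
    rintro ⟨σ, n, g, v⟩ hp
    simp only
    rw [← sum_filter, sum_const, nsmul_eq_mul]
    have hgcd : (σ * n : ℤ).gcd q = n.gcd q := by
      have hσ : σ = 1 ∨ σ = -1 := by simpa using (mem_product.mp hp).1
      rcases hσ with rfl | rfl <;> simp
    have := card_le_of_sq_mul_modEq
      {a ∈ S | (q : ℤ) ∣ a ^ 2 * (σ * n) - j * (g ^ 2 * v : ℕ)} q hq j (σ * n) (g ^ 2 * v : ℕ) R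
      (fun d hd hdq => hR d hd (hdq.trans hqB)) (fun a ha => hS a (mem_filter.mp ha).1)
      (fun a ha => (mem_filter.mp ha).2)
    rw [hgcd] at this
    calc _ ≤ (5 * R * (n.gcd q : ℕ)) * ((n : ℝ)⁻¹ * ((g : ℝ)⁻¹ * (v : ℝ)⁻¹)) := by gcongr
      _ = _ := by rw [div_eq_mul_inv]; ring
  have hsum : ∑ p ∈ ({1, -1} : Finset ℤ) ×ˢ Icc 1 X ×ˢ Icc 1 Y ×ˢ Icc 1 (Y ^ 2),
      (((p.2.1.gcd q : ℕ) : ℝ) / p.2.1 * ((p.2.2.1 : ℝ)⁻¹ * (p.2.2.2 : ℝ)⁻¹)) ≤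
        2 * ((R * R) * (R * R)) := by
    rw [sum_product]
    simp only [sum_product, ← mul_sum, ← sum_mul]
    rw [sum_const, nsmul_eq_mul]
    have hc : #({1, -1} : Finset ℤ) = 2 := rfl
    rw [hc]
    have h1 : ∑ n ∈ Icc 1 X, ((n.gcd q : ℕ) : ℝ) / n ≤ R * R :=
      (sum_gcd_div_le q X hq).trans
        (mul_le_mul (hR q hq.ne' hqB) (hharm X hXB) (sum_nonneg fun _ _ => by positivity)
          (by positivity))
    have h2 := mul_le_mul hRY (hharm _ hYB) (sum_nonneg fun _ _ => by positivity)
      (zero_le_one.trans hR1)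
    have h3 := mul_le_mul h1 h2 (mul_nonneg (sum_nonneg fun _ _ => by positivity)
      (sum_nonneg fun _ _ => by positivity)) (by positivity)
    push_cast
    linarith
  calc _ ≤ 24 * R * X * Y * (5 * R * (2 * ((R * R) * (R * R)))) := by
        refine mul_le_mul_of_nonneg_left ((sum_le_sum hinner).trans ?_) (by positivity)
        rw [← mul_sum]
        exact mul_le_mul_of_nonneg_left hsum (by positivity)
    _ = _ := by ring

/-! ### Moments of the number of modular square roots -/

/-- The roots are integers in an interval of length `r` with congruent squares. The loss `g`
satisfies `g² ∣ r` and `g ∣ 2k₀`, hence `g² ∣ 4k₀² ≡ 4jm`: many roots force a large square factor of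
`4m`. -/
lemma card_modSqrts_le (r j m : ℕ) (hr : 0 < r) (hj : r.Coprime j) :
    ∃ g ∈ r.divisors, g ^ 2 ∣ 4 * m ∧ (#(modSqrts r (j * m)) : ℝ) ≤ 2 * #r.divisors * g := by
  rcases (modSqrts r (j * m)).eq_empty_or_nonempty with h0 | ⟨k₀, hk₀⟩
  · exact ⟨1, Nat.one_mem_divisors.mpr hr.ne', by simp, by rw [h0]; simp⟩
  have hk₀' := (mem_filter.mp hk₀).2
  obtain ⟨g, hg0, hgr, hg2, hcard⟩ := card_le_of_dvd_sq_sub_sq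
    ((modSqrts r (j * m)).image ((↑) : ℕ → ℤ)) 0 k₀ r r hr
    (fun x hx => by
      obtain ⟨k, hk, rfl⟩ := mem_image.mp hx
      have := mem_range.mp (mem_filter.mp hk).1
      constructor <;> omega)
    (fun x hx => by
      obtain ⟨k, hk, rfl⟩ := mem_image.mp hx
      have := (hk₀'.trans (mem_filter.mp hk).2.symm).dvd
      push_cast at this
      exact this)
  have hr0 : (r : ℝ) ≠ 0 := by exact_mod_cast hr.ne'
  refine ⟨g, Nat.mem_divisors.mpr ⟨(dvd_pow_self g two_ne_zero).trans hgr, hr.ne'⟩, ?_, ?_⟩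
  · have h1 : g ∣ 2 * k₀ := by exact_mod_cast hg2
    have h2 : g ^ 2 ∣ 4 * k₀ ^ 2 := by
      have := pow_dvd_pow_of_dvd h1 2
      rwa [mul_pow] at this
    have h3 : 4 * k₀ ^ 2 ≡ 4 * (j * m) [MOD g ^ 2] := (hk₀'.of_dvd hgr).mul_left 4
    have h4 : g ^ 2 ∣ j * (4 * m) := by
      have := (h3.dvd_iff (dvd_refl _)).mp h2
      rwa [show 4 * (j * m) = j * (4 * m) by ring] at this
    exact (hj.of_dvd_left hgr).dvd_of_dvd_mul_left h4
  · rw [card_image_of_injective _ Nat.cast_injective] at hcard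
    have hg1 : (1 : ℝ) ≤ g := by exact_mod_cast hg0
    calc (#(modSqrts r (j * m)) : ℝ) ≤ #r.divisors * (1 + r * g / r) := hcard
      _ = #r.divisors * (1 + g) := by rw [mul_div_cancel_left₀ _ hr0]
      _ ≤ #r.divisors * (g + g) := by gcongr
      _ = _ := by ring

/-- A factor `g²` in the squared count is offset by the condition `g² ∣ 4m`, which at most `4M / g²`
values of `m` satisfy. -/
lemma sum_card_modSqrts_sq_le (r j M : ℕ) (R : ℝ) (hr : 0 < r) (hj : r.Coprime j)
    (hR : (#r.divisors : ℝ) ≤ R) :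
    ∑ m ∈ Icc 1 M, (#(modSqrts r (j * m)) : ℝ) ^ 2 ≤ 16 * R ^ 3 * M := by
  have hR0 : 0 ≤ R := le_trans (Nat.cast_nonneg _) hR
  have h1 : ∀ m ∈ Icc 1 M, (#(modSqrts r (j * m)) : ℝ) ^ 2 ≤
      4 * R ^ 2 * ∑ g ∈ r.divisors, if g ^ 2 ∣ 4 * m then (g : ℝ) ^ 2 else 0 := by
    intro m _
    obtain ⟨g, hg, hgm, hcard⟩ := card_modSqrts_le r j m hr hj
    have hs := single_le_sum (f := fun g : ℕ => if g ^ 2 ∣ 4 * m then (g : ℝ) ^ 2 else 0)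
      (fun g _ => by split_ifs <;> positivity) hg
    simp only [if_pos hgm] at hs
    calc (#(modSqrts r (j * m)) : ℝ) ^ 2 ≤ (2 * R * g) ^ 2 := by
          refine pow_le_pow_left₀ (by positivity) (hcard.trans ?_) 2
          gcongr
      _ = 4 * R ^ 2 * (g : ℝ) ^ 2 := by ring
      _ ≤ _ := by gcongr
  refine (sum_le_sum h1).trans ?_
  rw [← mul_sum, sum_comm]
  have h2 : ∀ g ∈ r.divisors, (∑ m ∈ Icc 1 M, if g ^ 2 ∣ 4 * m then (g : ℝ) ^ 2 else 0) ≤ 4 * M := by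
    intro g hg
    have hg0 : 0 < g ^ 2 := pow_pos (Nat.pos_of_mem_divisors hg) 2
    rw [← sum_filter, sum_const, nsmul_eq_mul]
    have hc : #{m ∈ Icc 1 M | g ^ 2 ∣ 4 * m} ≤ #(Icc 1 (4 * M / g ^ 2)) := by
      refine card_le_card_of_injOn (fun m => 4 * m / g ^ 2) (fun m hm => ?_) fun m hm n hn hmn => ?_
      · obtain ⟨hm1, hm2⟩ := mem_filter.mp hm
        rw [mem_Icc] at hm1
        rw [coe_Icc, Set.mem_Icc]
        exact ⟨Nat.div_pos (Nat.le_of_dvd (by omega) hm2) hg0, Nat.div_le_div_right (by omega)⟩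
      · have h3 := Nat.div_mul_cancel (mem_filter.mp hm).2
        have h4 := Nat.div_mul_cancel (mem_filter.mp hn).2
        simp only at hmn
        rw [hmn, h4] at h3
        omega
    rw [Nat.card_Icc, Nat.add_sub_cancel] at hc
    calc _ ≤ ((4 * M / g ^ 2 : ℕ) : ℝ) * (g : ℝ) ^ 2 := by gcongr
      _ ≤ _ := by exact_mod_cast Nat.div_mul_le_self (4 * M) (g ^ 2)
  have h3 := sum_le_card_nsmul _ _ _ h2
  rw [nsmul_eq_mul] at h3
  calc _ ≤ 4 * R ^ 2 * (#r.divisors * (4 * M)) := by gcongr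
    _ ≤ 4 * R ^ 2 * (R * (4 * M)) := by gcongr
    _ = _ := by ring

/-! ### Points, close pairs and their trivial count -/

/-- The pairs `(m, k)` with `1 ≤ m ≤ M` and `k` a square root of `j m` modulo `r`. -/
def sqrtPoints (r j M : ℕ) : Finset (ℕ × ℕ) :=
  (Icc 1 M ×ˢ range r).filter fun x => x.2 ^ 2 ≡ j * x.1 [MOD r]

/-- The pairs of points `(m₁, k₁)`, `(m₂, k₂)` with `|m₁ - m₂| ≤ H` and `|k₁ - k₂| ≤ A`. -/
def closePairs (r j M H A : ℕ) : Finset ((ℕ × ℕ) × (ℕ × ℕ)) :=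
  (sqrtPoints r j M ×ˢ sqrtPoints r j M).filter fun p =>
    |(p.2.1 : ℤ) - p.1.1| ≤ H ∧ |(p.2.2 : ℤ) - p.1.2| ≤ A

lemma mem_sqrtPoints {r j M : ℕ} {x : ℕ × ℕ} :
    x ∈ sqrtPoints r j M ↔ x.1 ∈ Icc 1 M ∧ x.2 ∈ modSqrts r (j * x.1) := by
  simp only [sqrtPoints, modSqrts, mem_filter, mem_product]
  tauto

lemma dvd_of_mem_sqrtPoints {r j M : ℕ} {x : ℕ × ℕ} (hx : x ∈ sqrtPoints r j M) :
    (r : ℤ) ∣ (x.2 : ℤ) ^ 2 - j * x.1 := by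
  have := (mem_filter.mp hx).2.symm.dvd
  push_cast at this
  exact this

lemma card_sqrtPoints (r j M : ℕ) :
    #(sqrtPoints r j M) = ∑ m ∈ Icc 1 M, #(modSqrts r (j * m)) := by
  rw [card_eq_sum_card_fiberwise (f := Prod.fst) (t := Icc 1 M)
    fun x hx => (mem_sqrtPoints.mp hx).1]
  refine sum_congr rfl fun m hm => ?_
  refine card_bij (fun x _ => x.2) (fun x hx => ?_) (fun x hx y hy hxy => ?_) fun k hk => ?_
  · obtain ⟨h1, rfl⟩ := mem_filter.mp hx
    exact (mem_sqrtPoints.mp h1).2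
  · exact Prod.ext ((mem_filter.mp hx).2.trans (mem_filter.mp hy).2.symm) hxy
  · exact ⟨(m, k), mem_filter.mpr ⟨mem_sqrtPoints.mpr ⟨hm, hk⟩, rfl⟩, rfl⟩

/-- The residue `k` determines `m`. -/
lemma eq_of_mem_sqrtPoints {r j M : ℕ} (hj : r.Coprime j) (hM : M ≤ r) {x y : ℕ × ℕ}
    (hx : x ∈ sqrtPoints r j M) (hy : y ∈ sqrtPoints r j M) (h : x.2 = y.2) : x = y := by
  have hx1 := mem_Icc.mp (mem_sqrtPoints.mp hx).1
  have hy1 := mem_Icc.mp (mem_sqrtPoints.mp hy).1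
  have h1 := dvd_sub (dvd_of_mem_sqrtPoints hx) (dvd_of_mem_sqrtPoints hy)
  rw [h, show (y.2 : ℤ) ^ 2 - j * x.1 - ((y.2 : ℤ) ^ 2 - j * y.1) = j * ((y.1 : ℤ) - x.1) by ring]
    at h1
  have h2 := (Nat.isCoprime_iff_coprime.mpr hj).dvd_of_dvd_mul_left h1
  have h3 := Int.eq_zero_of_abs_lt_dvd h2 (by rw [abs_lt]; constructor <;> omega)
  exact Prod.ext (by omega) h

lemma card_sqrtPoints_le (r j M : ℕ) (R : ℝ) (hr : 0 < r) (hj : r.Coprime j)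
    (hR : (#r.divisors : ℝ) ≤ R) : (#(sqrtPoints r j M) : ℝ) ≤ 16 * R ^ 3 * M := by
  rw [card_sqrtPoints]
  push_cast
  refine (sum_le_sum fun m _ => ?_).trans (sum_card_modSqrts_sq_le r j M R hr hj hR)
  exact_mod_cast Nat.le_self_pow two_ne_zero _

/-- The condition on `k₁ - k₂` is dropped. By `xy ≤ (x² + y²) / 2` the second moment of the root
count suffices, as each `m` has at most `2H + 1 ≤ 3H` neighbours. -/
lemma card_closePairs_le_mul (r j M H A : ℕ) (R : ℝ) (hr : 0 < r) (hj : r.Coprime j)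
    (hH : 1 ≤ H) (hR : (#r.divisors : ℝ) ≤ R) :
    (#(closePairs r j M H A) : ℝ) ≤ 48 * R ^ 3 * (H * M) := by
  set P := (Icc 1 M ×ˢ Icc 1 M).filter fun p : ℕ × ℕ => |(p.2 : ℤ) - p.1| ≤ H
  set ρ : ℕ → ℝ := fun m => #(modSqrts r (j * m))
  have h1 : (#(closePairs r j M H A) : ℝ) ≤ ∑ p ∈ P, ρ p.1 * ρ p.2 := by
    rw [card_eq_sum_card_fiberwise (f := fun p => (p.1.1, p.2.1)) (t := P)]
    · push_cast
      refine sum_le_sum fun p _ => ?_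
      have : #{x ∈ closePairs r j M H A | (x.1.1, x.2.1) = p} ≤
          #(modSqrts r (j * p.1) ×ˢ modSqrts r (j * p.2)) := by
        refine card_le_card_of_injOn (fun x => (x.1.2, x.2.2)) (fun x hx => ?_) fun x hx y hy hxy => ?_
        · obtain ⟨hx1, rfl⟩ := mem_filter.mp hx
          obtain ⟨hx2, hx3⟩ := mem_product.mp (mem_filter.mp hx1).1
          exact mem_product.mpr ⟨(mem_sqrtPoints.mp hx2).2, (mem_sqrtPoints.mp hx3).2⟩
        · have hx1 := (mem_filter.mp hx).2
          have hy1 := (mem_filter.mp hy).2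
          simp only [Prod.mk.injEq] at hxy
          rw [← hy1, Prod.mk.injEq] at hx1
          exact Prod.ext (Prod.ext hx1.1 hxy.1) (Prod.ext hx1.2 hxy.2)
      rw [card_product] at this
      calc _ ≤ ((#(modSqrts r (j * p.1)) * #(modSqrts r (j * p.2)) : ℕ) : ℝ) := Nat.cast_le.mpr this
        _ = _ := Nat.cast_mul _ _
    · intro x hx
      obtain ⟨hx1, hx2, -⟩ := mem_filter.mp hx
      obtain ⟨hx3, hx4⟩ := mem_product.mp hx1
      exact mem_filter.mpr ⟨mem_product.mpr ⟨(mem_sqrtPoints.mp hx3).1, (mem_sqrtPoints.mp hx4).1⟩, hx2⟩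
  have hdeg : ∀ m : ℕ, (#((Icc 1 M).filter fun n : ℕ => |(n : ℤ) - m| ≤ H) : ℝ) ≤ 3 * H := by
    intro m
    have : ((Icc 1 M).filter fun n : ℕ => |(n : ℤ) - m| ≤ H) ⊆ Icc (m - H) (m + H) := by
      intro n hn
      have := abs_le.mp (mem_filter.mp hn).2
      rw [mem_Icc]
      omega
    have h0 : #(Icc (m - H) (m + H)) ≤ 3 * H := by
      rw [Nat.card_Icc]
      omega
    calc _ ≤ ((3 * H : ℕ) : ℝ) := Nat.cast_le.mpr ((card_le_card this).trans h0)
      _ = _ := by push_cast; rfl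
  have h2 : ∑ p ∈ P, ρ p.1 ^ 2 ≤ 3 * H * ∑ m ∈ Icc 1 M, ρ m ^ 2 := by
    rw [sum_filter, sum_product, mul_sum]
    refine sum_le_sum fun m _ => ?_
    simp only
    rw [← sum_filter, sum_const, nsmul_eq_mul]
    gcongr
    exact hdeg m
  have h3 : ∑ p ∈ P, ρ p.2 ^ 2 ≤ 3 * H * ∑ m ∈ Icc 1 M, ρ m ^ 2 := by
    rw [sum_filter, sum_product_right, mul_sum]
    refine sum_le_sum fun m _ => ?_
    simp only
    rw [← sum_filter, sum_const, nsmul_eq_mul]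
    gcongr
    simp only [abs_sub_comm (m : ℤ)]
    exact hdeg m
  have h4 : ∑ p ∈ P, ρ p.1 * ρ p.2 ≤ ∑ p ∈ P, (ρ p.1 ^ 2 + ρ p.2 ^ 2) / 2 :=
    sum_le_sum fun p _ => by nlinarith [sq_nonneg (ρ p.1 - ρ p.2)]
  rw [← sum_div, sum_add_distrib] at h4
  have h5 : 3 * (H : ℝ) * ∑ m ∈ Icc 1 M, ρ m ^ 2 ≤ 3 * H * (16 * R ^ 3 * M) := by
    gcongr
    exact sum_card_modSqrts_sq_le r j M R hr hj hR
  linarith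

/-! ### Off-diagonal pairs and reduced differences -/

/-- The nonzero integers `a` with `|a| ≤ A`. -/
noncomputable def offsets (A : ℕ) : Finset ℤ := (Icc (-A : ℤ) A).filter (· ≠ 0)

/-- For the pairs of `Ω` with `k₂ - k₁ = a`, the differences `m₂ - m₁` divided by `gcd(a, r)`. -/
noncomputable def reducedDiffs (Ω : Finset ((ℕ × ℕ) × (ℕ × ℕ))) (r : ℕ) (a : ℤ) : Finset ℤ :=
  (Ω.filter fun p => (p.2.2 : ℤ) - p.1.2 = a).image
    fun p => ((p.2.1 : ℤ) - p.1.1) / (a.gcd r : ℕ)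

lemma mem_closePairs {r j M H A : ℕ} {p : (ℕ × ℕ) × (ℕ × ℕ)} :
    p ∈ closePairs r j M H A ↔ (p.1 ∈ sqrtPoints r j M ∧ p.2 ∈ sqrtPoints r j M) ∧
      |(p.2.1 : ℤ) - p.1.1| ≤ H ∧ |(p.2.2 : ℤ) - p.1.2| ≤ A := by
  rw [closePairs, mem_filter, mem_product]

lemma dvd_of_mem_closePairs {r j M H A : ℕ} {p : (ℕ × ℕ) × (ℕ × ℕ)}
    (hp : p ∈ closePairs r j M H A) {a : ℤ} (ha : (p.2.2 : ℤ) - p.1.2 = a) :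
    (r : ℤ) ∣ a * (2 * p.1.2 + a) - j * ((p.2.1 : ℤ) - p.1.1) := by
  have h := dvd_sub (dvd_of_mem_sqrtPoints (mem_closePairs.mp hp).1.2)
    (dvd_of_mem_sqrtPoints (mem_closePairs.mp hp).1.1)
  have e : a * (2 * p.1.2 + a) - j * ((p.2.1 : ℤ) - p.1.1) =
      (p.2.2 : ℤ) ^ 2 - j * p.2.1 - ((p.1.2 : ℤ) ^ 2 - j * p.1.1) := by
    rw [← ha]; ring
  rwa [e]

lemma gcd_dvd_of_mem_closePairs {r j M H A : ℕ} (hj : r.Coprime j) {p : (ℕ × ℕ) × (ℕ × ℕ)}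
    (hp : p ∈ closePairs r j M H A) {a : ℤ} (ha : (p.2.2 : ℤ) - p.1.2 = a) :
    ((a.gcd r : ℕ) : ℤ) ∣ (p.2.1 : ℤ) - p.1.1 := by
  have hg : ((a.gcd r : ℕ) : ℤ) ∣ r := Int.gcd_dvd_right a (r : ℤ)
  have h1 := hg.trans (dvd_of_mem_closePairs hp ha)
  have h2 : ((a.gcd r : ℕ) : ℤ) ∣ a * (2 * p.1.2 + a) := (Int.gcd_dvd_left a (r : ℤ)).mul_right _
  have h3 := (dvd_sub_right h2).mp h1
  exact ((Nat.isCoprime_iff_coprime.mpr hj).of_isCoprime_of_dvd_left hg).dvd_of_dvd_mul_left h3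

/-- Once `a` and `m₂ - m₁` are fixed, `a (2k₁ + a) ≡ j (m₂ - m₁)` determines `k₁` modulo `r /
gcd(2a, r)`. This leaves at most `gcd(2a, r) + 1 ≤ 3 gcd(a, r)` values of `k₁`, and `k₁` with `k₂ =
k₁ + a` determines the pair. -/
lemma card_filter_reducedDiff_le {r j M H A : ℕ} (hr : 0 < r) (hj : r.Coprime j) (hM : M ≤ r)
    {Ω : Finset ((ℕ × ℕ) × (ℕ × ℕ))} (hΩ : Ω ⊆ closePairs r j M H A) (a : ℤ) :
    #{p ∈ Ω | (p.2.2 : ℤ) - p.1.2 = a} ≤ 3 * a.gcd r * #(reducedDiffs Ω r a) := by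
  have hg0 : 0 < a.gcd r := Int.gcd_pos_of_ne_zero_right _ (by exact_mod_cast hr.ne')
  refine card_le_mul_card_image _ _ fun h _ => ?_
  set W := {p ∈ {p ∈ Ω | (p.2.2 : ℤ) - p.1.2 = a} | ((p.2.1 : ℤ) - p.1.1) / (a.gcd r : ℕ) = h}
  have hW : ∀ p ∈ W, p ∈ closePairs r j M H A ∧ (p.2.2 : ℤ) - p.1.2 = a ∧
      (p.2.1 : ℤ) - p.1.1 = (a.gcd r : ℕ) * h := by
    intro p hp
    obtain ⟨h1, h2⟩ := mem_filter.mp hp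
    obtain ⟨h3, h4⟩ := mem_filter.mp h1
    exact ⟨hΩ h3, h4, by rw [← h2, Int.mul_ediv_cancel' (gcd_dvd_of_mem_closePairs hj (hΩ h3) h4)]⟩
  set G := (2 * a).gcd r
  have hG0 : 0 < G := Int.gcd_pos_of_ne_zero_right _ (by exact_mod_cast hr.ne')
  obtain ⟨d, hd⟩ : G ∣ r := by exact_mod_cast Int.gcd_dvd_right (2 * a) (r : ℤ)
  obtain ⟨c, hc⟩ : (G : ℤ) ∣ 2 * a := Int.gcd_dvd_left (2 * a) (r : ℤ)
  have hd0 : 0 < d := Nat.pos_of_ne_zero (by rintro rfl; simp at hd; omega)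
  have hG2 : G ≤ 2 * a.gcd r := by
    have h1 : G ∣ (2 * a).gcd (2 * r) := Int.gcd_dvd_gcd_of_dvd_right _ (dvd_mul_left _ _)
    have h2 : (2 * a).gcd (2 * r) = 2 * a.gcd r := by rw [Int.gcd_mul_left]; rfl
    exact Nat.le_of_dvd (by omega) (h2 ▸ h1)
  have hcop : IsCoprime c (d : ℤ) := by
    rw [Int.isCoprime_iff_gcd_eq_one]
    have h1 : (2 * a).gcd r = G * c.gcd d := by
      conv_lhs => rw [hc, hd]
      push_cast
      rw [Int.gcd_mul_left]; simp
    exact (Nat.eq_of_mul_eq_mul_left hG0 ((mul_one G).trans h1)).symm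
  have hinj : Set.InjOn (fun p : (ℕ × ℕ) × (ℕ × ℕ) => (p.1.2 : ℤ)) W := by
    intro p hp p' hp' hpp
    obtain ⟨h1, h2, -⟩ := hW p hp
    obtain ⟨h3, h4, -⟩ := hW p' hp'
    simp only at hpp
    rw [mem_closePairs] at h1 h3
    exact Prod.ext (eq_of_mem_sqrtPoints hj hM h1.1.1 h3.1.1 (by omega))
      (eq_of_mem_sqrtPoints hj hM h1.1.2 h3.1.2 (by omega))
  have hcard := card_le_of_pairwise_dvd_sub (W.image fun p => (p.1.2 : ℤ)) 0 r d hd0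
    (fun x hx => by
      obtain ⟨p, hp, rfl⟩ := mem_image.mp hx
      have := mem_range.mp (mem_filter.mp (mem_sqrtPoints.mp (mem_closePairs.mp (hW p hp).1).1.1).2).1
      constructor <;> omega)
    (fun x hx y hy => by
      obtain ⟨p, hp, rfl⟩ := mem_image.mp hx
      obtain ⟨p', hp', rfl⟩ := mem_image.mp hy
      obtain ⟨h1, h2, h3⟩ := hW p hp
      obtain ⟨h4, h5, h6⟩ := hW p' hp'
      have h7 := dvd_sub (dvd_of_mem_closePairs h1 h2) (dvd_of_mem_closePairs h4 h5)
      rw [h3, h6] at h7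
      have e : a * (2 * (p.1.2 : ℤ) + a) - j * ((a.gcd r : ℕ) * h) -
          (a * (2 * (p'.1.2 : ℤ) + a) - j * ((a.gcd r : ℕ) * h)) =
          G * (c * ((p.1.2 : ℤ) - p'.1.2)) := by
        linear_combination ((p.1.2 : ℤ) - p'.1.2) * hc
      rw [e, hd] at h7
      push_cast at h7
      exact hcop.symm.dvd_of_dvd_mul_left
        ((mul_dvd_mul_iff_left (by exact_mod_cast hG0.ne' : (G : ℤ) ≠ 0)).mp h7))
  rw [card_image_of_injOn hinj] at hcard
  have hrd : (r : ℝ) / d = G := by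
    rw [div_eq_iff (by exact_mod_cast hd0.ne')]
    exact_mod_cast hd
  rw [hrd] at hcard
  have : #W ≤ G + 1 := by exact_mod_cast hcard
  omega

lemma card_le_sum_gcd_mul_card_reducedDiffs {r j M H A : ℕ} (hr : 0 < r) (hj : r.Coprime j)
    (hM : M ≤ r) {Ω : Finset ((ℕ × ℕ) × (ℕ × ℕ))} (hΩ : Ω ⊆ closePairs r j M H A)
    (hne : ∀ p ∈ Ω, p.1.2 ≠ p.2.2) :
    #Ω ≤ ∑ a ∈ offsets A, 3 * a.gcd r * #(reducedDiffs Ω r a) := by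
  rw [card_eq_sum_card_fiberwise (f := fun p : (ℕ × ℕ) × (ℕ × ℕ) => (p.2.2 : ℤ) - p.1.2)
    (t := offsets A)]
  · exact sum_le_sum fun a _ => card_filter_reducedDiff_le hr hj hM hΩ a
  · intro p hp
    have h1 := (mem_closePairs.mp (hΩ hp)).2.2
    have h2 := hne p hp
    exact mem_filter.mpr ⟨mem_Icc.mpr (abs_le.mp h1), fun (h0 : (p.2.2 : ℤ) - p.1.2 = 0) => h2 (by omega)⟩

lemma abs_le_of_mem_reducedDiffs {r j M H A : ℕ} (hr : 0 < r) (hj : r.Coprime j)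
    {Ω : Finset ((ℕ × ℕ) × (ℕ × ℕ))} (hΩ : Ω ⊆ closePairs r j M H A) {a h : ℤ}
    (hh : h ∈ reducedDiffs Ω r a) : |h| ≤ (H / a.gcd r : ℕ) := by
  obtain ⟨p, hp, rfl⟩ := mem_image.mp hh
  obtain ⟨hp1, hp2⟩ := mem_filter.mp hp
  have hg0 : 0 < a.gcd r := Int.gcd_pos_of_ne_zero_right _ (by exact_mod_cast hr.ne')
  obtain ⟨t, ht⟩ := gcd_dvd_of_mem_closePairs hj (hΩ hp1) hp2
  have hg0' : (0 : ℤ) < (a.gcd r : ℕ) := by exact_mod_cast hg0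
  have h1 := (mem_closePairs.mp (hΩ hp1)).2.1
  rw [ht, abs_mul, abs_of_pos hg0'] at h1
  rw [ht, Int.mul_ediv_cancel_left _ hg0'.ne']
  push_cast
  rw [Int.le_ediv_iff_mul_le hg0', mul_comm]
  exact h1

/-- Excluding `0` avoids a term `+1`, which would be fatal for `d > A`. -/
lemma card_offsets_filter_dvd_mul_le (A d : ℕ) (hd : 0 < d) :
    #{a ∈ offsets A | (d : ℤ) ∣ a} * d ≤ 2 * A := by
  have hd' : (0 : ℤ) < d := by exact_mod_cast hd
  have hc : #{a ∈ offsets A | (d : ℤ) ∣ a} ≤ #((Icc (-(A / d : ℕ) : ℤ) (A / d : ℕ)).erase 0) := by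
    refine card_le_card_of_injOn (fun a => a / d) (fun a ha => ?_) fun a ha b hb hab => ?_
    · obtain ⟨ha1, t, rfl⟩ := mem_filter.mp ha
      obtain ⟨ha2, ha3⟩ := mem_filter.mp ha1
      simp only [Int.mul_ediv_cancel_left _ hd'.ne']
      refine mem_erase.mpr ⟨by rintro rfl; simp at ha3, ?_⟩
      rw [mem_Icc, ← abs_le] at ha2 ⊢
      rw [abs_mul, abs_of_pos hd'] at ha2
      push_cast
      rw [Int.le_ediv_iff_mul_le hd', mul_comm]
      exact ha2
    · obtain ⟨-, t, rfl⟩ := mem_filter.mp (mem_coe.mp ha)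
      obtain ⟨-, s, rfl⟩ := mem_filter.mp (mem_coe.mp hb)
      simp only [Int.mul_ediv_cancel_left _ hd'.ne'] at hab
      rw [hab]
  have h2 : #{a ∈ offsets A | (d : ℤ) ∣ a} ≤ 2 * (A / d) := by
    generalize A / d = c at hc ⊢
    rw [card_erase_of_mem (by rw [mem_Icc]; constructor <;> omega), Int.card_Icc] at hc
    omega
  calc _ ≤ 2 * (A / d) * d := Nat.mul_le_mul_right d h2
    _ = 2 * (A / d * d) := by ring
    _ ≤ _ := Nat.mul_le_mul_left 2 (Nat.div_mul_le_self A d)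

lemma card_offsets (A : ℕ) : #(offsets A) ≤ 2 * A := by
  have := card_offsets_filter_dvd_mul_le A 1 one_pos
  simpa using this

lemma sum_gcd_offsets_le (A r : ℕ) (hr : 0 < r) :
    ∑ a ∈ offsets A, a.gcd r ≤ #r.divisors * (2 * A) := by
  have h1 : ∀ a ∈ offsets A, a.gcd r ≤ ∑ d ∈ r.divisors, if (d : ℤ) ∣ a then d else 0 := by
    intro a _
    have hmem : a.gcd r ∈ r.divisors :=
      Nat.mem_divisors.mpr ⟨by exact_mod_cast Int.gcd_dvd_right a (r : ℤ), hr.ne'⟩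
    refine le_trans ?_ (single_le_sum (fun d _ => Nat.zero_le _) hmem)
    rw [if_pos (Int.gcd_dvd_left a (r : ℤ))]
  refine (sum_le_sum h1).trans ?_
  rw [sum_comm, ← smul_eq_mul]
  refine sum_le_card_nsmul _ _ _ fun d hd => ?_
  rw [← sum_filter, sum_const, smul_eq_mul]
  exact card_offsets_filter_dvd_mul_le A d (Nat.pos_of_mem_divisors hd)

/-- The trivial bound for pairs with `k₁ ≠ k₂`. -/
lemma card_offDiag_le {r j M H A : ℕ} (hr : 0 < r) (hj : r.Coprime j) (hM : M ≤ r) (hH : 1 ≤ H) :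
    #{p ∈ closePairs r j M H A | p.1.2 ≠ p.2.2} ≤ 18 * #r.divisors * (A * H) := by
  refine (card_le_sum_gcd_mul_card_reducedDiffs hr hj hM (filter_subset _ _)
    fun p hp => (mem_filter.mp hp).2).trans ?_
  have h1 : ∀ a ∈ offsets A, 3 * a.gcd r *
      #(reducedDiffs {p ∈ closePairs r j M H A | p.1.2 ≠ p.2.2} r a) ≤ 6 * H + 3 * a.gcd r := by
    intro a _
    have hsub : reducedDiffs {p ∈ closePairs r j M H A | p.1.2 ≠ p.2.2} r a ⊆
        Icc (-(H / a.gcd r : ℕ) : ℤ) (H / a.gcd r : ℕ) := fun h hh =>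
      mem_Icc.mpr (abs_le.mp (abs_le_of_mem_reducedDiffs hr hj (filter_subset _ _) hh))
    have hc := card_le_card hsub
    rw [Int.card_Icc] at hc
    have h2 : #(reducedDiffs {p ∈ closePairs r j M H A | p.1.2 ≠ p.2.2} r a) ≤
        2 * (H / a.gcd r) + 1 := by
      generalize H / a.gcd r = c at hc ⊢
      omega
    have h3 := Nat.mul_le_mul_left (3 * a.gcd r) h2
    have h4 := Nat.mul_div_le H (a.gcd r)
    nlinarith
  refine (sum_le_sum h1).trans ?_
  rw [sum_add_distrib, sum_const, smul_eq_mul, ← mul_sum]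
  have h2 := card_offsets A
  have h3 := sum_gcd_offsets_le A r hr
  have h4 : 1 ≤ #r.divisors := card_pos.mpr ⟨1, Nat.one_mem_divisors.mpr hr.ne'⟩
  calc _ ≤ 2 * A * (6 * H) + 3 * (#r.divisors * (2 * A)) := by gcongr
    _ ≤ #r.divisors * (2 * A * (6 * H)) + 3 * (#r.divisors * (2 * (A * H))) := by
        have h5 : A ≤ A * H := Nat.le_mul_of_pos_right _ hH
        refine add_le_add (Nat.le_mul_of_pos_left _ h4) ?_
        gcongr
    _ = _ := by ring

/-- Second moment of the number of reduced differences with weight `gcd(a, r)`, for pairs with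
`m₁ + m₂` in a short interval. -/
lemma sum_gcd_mul_card_reducedDiffs_sq_le {r j M H A N : ℕ} {R : ℝ} (hr : 0 < r) (hj : r.Coprime j)
    (hHr : H ≤ r) (hAr : A ≤ r) (hN : 1 ≤ N) (hH : 1 ≤ H) (hsmall : 4 * N * H ^ 2 < r)
    (hR : ∀ d : ℕ, d ≠ 0 → d ≤ r ^ 2 → (#d.divisors : ℝ) ≤ R)
    (hharm : ∀ n : ℕ, n ≤ r ^ 2 → ∑ i ∈ Icc 1 n, (i : ℝ)⁻¹ ≤ R)
    {Ω : Finset ((ℕ × ℕ) × (ℕ × ℕ))} (hΩ : Ω ⊆ closePairs r j M H A)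
    (hshort : ∀ p ∈ Ω, ∀ p' ∈ Ω, |((p.1.1 : ℤ) + p.2.1) - (p'.1.1 + p'.2.1)| ≤ N) :
    ∑ a ∈ offsets A, (a.gcd r : ℝ) * (#(reducedDiffs Ω r a) : ℝ) ^ 2 ≤
      480 * R ^ 7 * (A + N * H) := by
  have hR1 : 1 ≤ R := by simpa using hR 1 one_ne_zero (pow_pos hr 2)
  have hrr : r ≤ r ^ 2 := Nat.le_self_pow two_ne_zero r
  -- Sort by `g = gcd(a, r)`. Dividing `a` by `g` gives units modulo `q = r / g`, and summing over
  -- `g` costs one more factor `R`.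
  rw [← sum_fiberwise_of_maps_to (t := r.divisors) (g := fun a : ℤ => a.gcd r) fun a _ =>
    Nat.mem_divisors.mpr ⟨by exact_mod_cast Int.gcd_dvd_right a (r : ℤ), hr.ne'⟩]
  have hfib : ∀ g ∈ r.divisors,
      ∑ a ∈ offsets A with a.gcd r = g, (a.gcd r : ℝ) * (#(reducedDiffs Ω r a) : ℝ) ^ 2 ≤
        480 * R ^ 6 * (A + N * H) := by
    intro g hg
    have hg0 : 0 < g := Nat.pos_of_mem_divisors hg
    have hg0' : (0 : ℤ) < g := by exact_mod_cast hg0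
    obtain ⟨q, hq⟩ := (Nat.mem_divisors.mp hg).1
    have hq0 : 0 < q := Nat.pos_of_ne_zero (by rintro rfl; simp at hq; omega)
    have hqr : q ≤ r := hq ▸ Nat.le_mul_of_pos_left q hg0
    have hrZ : (r : ℤ) = g * q := by exact_mod_cast hq
    set S : Finset ℤ := {a ∈ offsets A | a.gcd r = g}.image fun a => a / g
    have hSmem : ∀ a ∈ S, (g * a ∈ offsets A ∧ ((g : ℤ) * a).gcd r = g) := by
      intro a ha
      obtain ⟨b, hb, rfl⟩ := mem_image.mp ha
      obtain ⟨hb1, hb2⟩ := mem_filter.mp hb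
      have hgb : (g : ℤ) ∣ b := hb2 ▸ Int.gcd_dvd_left b (r : ℤ)
      rw [Int.mul_ediv_cancel' hgb]
      exact ⟨hb1, hb2⟩
    have hsum : ∑ a ∈ offsets A with a.gcd r = g, (a.gcd r : ℝ) * (#(reducedDiffs Ω r a) : ℝ) ^ 2 =
        g * ∑ a ∈ S, (#(reducedDiffs Ω r (g * a)) : ℝ) ^ 2 := by
      rw [sum_image, mul_sum]
      · refine sum_congr rfl fun a ha => ?_
        obtain ⟨-, ha2⟩ := mem_filter.mp ha
        have hga : (g : ℤ) ∣ a := ha2 ▸ Int.gcd_dvd_left a (r : ℤ)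
        rw [Int.mul_ediv_cancel' hga, ha2]
      · intro a ha b hb hab
        have ha2 := (mem_filter.mp (mem_coe.mp ha)).2
        have hb2 := (mem_filter.mp (mem_coe.mp hb)).2
        have hga : (g : ℤ) ∣ a := ha2 ▸ Int.gcd_dvd_left a (r : ℤ)
        have hgb : (g : ℤ) ∣ b := hb2 ▸ Int.gcd_dvd_left b (r : ℤ)
        simp only at hab
        rw [← Int.mul_ediv_cancel' hga, ← Int.mul_ediv_cancel' hgb, hab]
    have hScard : #S * g ≤ 2 * A := by
      refine (Nat.mul_le_mul_right g (card_image_le.trans (card_le_card fun a ha => ?_))).trans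
        (card_offsets_filter_dvd_mul_le A g hg0)
      obtain ⟨ha1, ha2⟩ := mem_filter.mp ha
      exact mem_filter.mpr ⟨ha1, ha2 ▸ Int.gcd_dvd_left a (r : ℤ)⟩
    -- Choose one pair for each reduced difference; the default value is never used.
    have hpt : ∀ a h : ℤ, ∃ p, h ∈ reducedDiffs Ω r (g * a) → a ∈ S →
        p ∈ Ω ∧ (p.2.2 : ℤ) - p.1.2 = g * a ∧ (p.2.1 : ℤ) - p.1.1 = g * h := by
      intro a h
      by_cases hh : h ∈ reducedDiffs Ω r (g * a) ∧ a ∈ S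
      · obtain ⟨p, hp, hph⟩ := mem_image.mp hh.1
        obtain ⟨hp1, hp2⟩ := mem_filter.mp hp
        have hdvd := gcd_dvd_of_mem_closePairs hj (hΩ hp1) hp2
        rw [(hSmem a hh.2).2] at hdvd hph
        exact ⟨p, fun _ _ => ⟨hp1, hp2, by rw [← hph, Int.mul_ediv_cancel' hdvd]⟩⟩
      · exact ⟨default, fun h1 h2 => absurd ⟨h1, h2⟩ hh⟩
    choose P hP using hpt
    set ν : ℤ → ℤ → ℤ := fun a h => 2 * (((P a h).1.1 : ℤ) + (P a h).2.1)
    have hcop : ∀ a ∈ S, IsCoprime a (q : ℤ) := by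
      intro a ha
      rw [Int.isCoprime_iff_gcd_eq_one]
      have h1 := (hSmem a ha).2
      rw [hrZ, Int.gcd_mul_left] at h1
      exact Nat.eq_of_mul_eq_mul_left hg0 (by simpa using h1)
    have hjq : IsCoprime (j : ℤ) (q : ℤ) :=
      (Nat.isCoprime_iff_coprime.mpr (hj.of_dvd_left (hq ▸ dvd_mul_left q g))).symm
    -- The parabola: modulo `q`, `j a² ν ≡ (a (k₁ + k₂))² + a² (k₂ - k₁)²`, where `a (k₁ + k₂) ≡ j
    -- h` and `k₂ - k₁ = g a`.
    have hkey : ∀ a ∈ S, ∀ h ∈ reducedDiffs Ω r (g * a),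
        (q : ℤ) ∣ j * (a ^ 2 * ν a h) - j ^ 2 * h ^ 2 - a ^ 4 * g ^ 2 := by
      intro a ha h hh
      obtain ⟨h1, h2, h3⟩ := hP a h hh ha
      obtain ⟨f, hf⟩ := dvd_of_mem_sqrtPoints (mem_closePairs.mp (hΩ h1)).1.1
      obtain ⟨e, he⟩ := dvd_of_mem_closePairs (hΩ h1) h2
      rw [h3, hrZ] at he
      rw [hrZ] at hf
      have he' : a * (2 * ((P a h).1.2 : ℤ) + g * a) - j * h = q * e :=
        mul_left_cancel₀ hg0'.ne' (by linear_combination he)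
      have h4 : ν a h = 2 * (2 * ((P a h).1.1 : ℤ) + g * h) := by
        simp only [ν]; linear_combination 2 * h3
      refine ⟨e * (q * e) + 2 * e * (j * h - a * (g * a)) - 4 * a ^ 2 * (g * f), ?_⟩
      rw [h4]
      linear_combination (a * (2 * ((P a h).1.2 : ℤ) + g * a) - j * h + q * e +
        2 * (j * h - a * (g * a))) * he' - 4 * a ^ 2 * hf
    -- The box has `X = 2N`, since `ν` doubles `m₁ + m₂`, and `Y = H / g`. Then `2XY² < q` follows
    -- from `4NH² < r`.
    have hcore := sum_card_sq_le S (fun a => reducedDiffs Ω r (g * a)) ν q (H / g) (2 * N) (r ^ 2)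
      j R hq0 hjq (by omega) ?_ hR hharm (hqr.trans hrr) ?_ ?_ ?_ ?_ ?_ ?_
    · rw [hsum]
      have hN' : ((H / g : ℕ) : ℝ) * g ≤ H := by exact_mod_cast Nat.div_mul_le_self H g
      have hS' : (#S : ℝ) * g ≤ 2 * A := by exact_mod_cast hScard
      have hpow : R ^ 2 ≤ R ^ 6 := pow_le_pow_right₀ hR1 (by norm_num)
      have hA0 : (0 : ℝ) ≤ A := Nat.cast_nonneg A
      calc (g : ℝ) * ∑ a ∈ S, (#(reducedDiffs Ω r (g * a)) : ℝ) ^ 2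
          ≤ g * (4 * R ^ 2 * #S + 240 * R ^ 6 * ((2 * N : ℕ) * (H / g : ℕ))) := by gcongr
        _ = 4 * R ^ 2 * (#S * g) + 480 * R ^ 6 * (N * ((H / g : ℕ) * g)) := by push_cast; ring
        _ ≤ 4 * R ^ 6 * (2 * A) + 480 * R ^ 6 * (N * H) := by gcongr
        _ ≤ _ := by nlinarith [mul_nonneg (pow_nonneg (zero_le_one.trans hR1) 6) hA0]
    · have h1 : 2 * (2 * N) * (H / g) ^ 2 * g ≤ 4 * N * H ^ 2 := by
        have h2 : (H / g) ^ 2 * g ≤ H ^ 2 := by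
          calc (H / g) ^ 2 * g = (H / g) * (H / g * g) := by ring
            _ ≤ H * H := Nat.mul_le_mul (Nat.div_le_self H g) (Nat.div_mul_le_self H g)
            _ = H ^ 2 := by ring
        calc _ = 4 * N * ((H / g) ^ 2 * g) := by ring
          _ ≤ _ := Nat.mul_le_mul_left _ h2
      have h3 := h1.trans_lt hsmall
      rw [hq, mul_comm g q] at h3
      exact lt_of_mul_lt_mul_right h3 (Nat.zero_le g)
    · exact Nat.pow_le_pow_left ((Nat.div_le_self H g).trans hHr) 2
    · have : 1 ≤ H ^ 2 := Nat.one_le_pow _ _ hH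
      nlinarith
    · intro a ha
      refine ⟨?_, hcop a ha⟩
      have h1 := abs_le.mpr (mem_Icc.mp (mem_filter.mp (hSmem a ha).1).1)
      rw [abs_mul, abs_of_pos hg0'] at h1
      have h2 : (A : ℤ) ≤ g * q := by rw [← hrZ]; exact_mod_cast hAr
      exact le_of_mul_le_mul_left (h1.trans h2) hg0'
    · intro a ha h hh
      have := abs_le_of_mem_reducedDiffs hr hj hΩ hh
      rwa [(hSmem a ha).2] at this
    · intro a ha h hh h' hh'
      have := hshort _ (hP a h hh ha).1 _ (hP a h' hh' ha).1
      simp only [ν]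
      rw [← mul_sub, abs_mul]
      push_cast
      simpa using this
    · intro a ha h hh h' hh'
      have h1 := dvd_sub (hkey a ha h hh) (hkey a ha h' hh')
      have e : (j : ℤ) * (a ^ 2 * ν a h) - j ^ 2 * h ^ 2 - a ^ 4 * g ^ 2 -
          (j * (a ^ 2 * ν a h') - j ^ 2 * h' ^ 2 - a ^ 4 * g ^ 2) =
          j * (a ^ 2 * (ν a h - ν a h') - j * (h ^ 2 - h' ^ 2)) := by ring
      rw [e] at h1
      exact hjq.symm.dvd_of_dvd_mul_left h1
  have h1 := sum_le_card_nsmul _ _ _ hfib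
  rw [nsmul_eq_mul] at h1
  calc _ ≤ _ := h1
    _ ≤ R * (480 * R ^ 6 * (A + N * H)) := by gcongr; exact hR r hr.ne' hrr
    _ = _ := by ring

/-- Pairs with `k₁ ≠ k₂`, by cutting the range of `m₁ + m₂` into intervals of length `N`. -/
lemma card_offDiag_sq_le {r j M H A N : ℕ} {R : ℝ} (hr : 0 < r) (hj : r.Coprime j)
    (hM : M ≤ r) (hHM : H ≤ M) (hAr : A ≤ r) (hN : 1 ≤ N) (hNM : N ≤ M) (hH : 1 ≤ H)
    (hsmall : 4 * N * H ^ 2 < r)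
    (hR : ∀ d : ℕ, d ≠ 0 → d ≤ r ^ 2 → (#d.divisors : ℝ) ≤ R)
    (hharm : ∀ n : ℕ, n ≤ r ^ 2 → ∑ i ∈ Icc 1 n, (i : ℝ)⁻¹ ≤ R) :
    (#{p ∈ closePairs r j M H A | p.1.2 ≠ p.2.2} : ℝ) ^ 2 ≤
      77760 * R ^ 8 * ((M / N) ^ 2 * (A ^ 2 + A * H * N)) := by
  have hR1 : 1 ≤ R := by simpa using hR 1 one_ne_zero (pow_pos hr 2)
  set Ω := {p ∈ closePairs r j M H A | p.1.2 ≠ p.2.2}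
  set I := range (2 * M / N + 1)
  set Ωi : ℕ → Finset ((ℕ × ℕ) × (ℕ × ℕ)) := fun i => {p ∈ Ω | (p.1.1 + p.2.1) / N = i}
  have hΩ : ∀ i, Ωi i ⊆ closePairs r j M H A := fun i =>
    (filter_subset _ _).trans (filter_subset _ _)
  have hmaps : ∀ p ∈ Ω, (p.1.1 + p.2.1) / N ∈ I := by
    intro p hp
    have h1 := (mem_closePairs.mp (mem_filter.mp hp).1).1
    have h2 := (mem_Icc.mp (mem_sqrtPoints.mp h1.1).1).2
    have h3 := (mem_Icc.mp (mem_sqrtPoints.mp h1.2).1).2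
    exact mem_range.mpr (Nat.lt_succ_of_le (Nat.div_le_div_right (by omega)))
  have hcard : (#Ω : ℝ) ≤ 3 * ∑ x ∈ I ×ˢ offsets A,
      (x.2.gcd r : ℝ) * (#(reducedDiffs (Ωi x.1) r x.2) : ℝ) := by
    have h1 : #Ω ≤ ∑ i ∈ I, ∑ a ∈ offsets A, 3 * a.gcd r * #(reducedDiffs (Ωi i) r a) := by
      rw [card_eq_sum_card_fiberwise hmaps]
      exact sum_le_sum fun i _ => card_le_sum_gcd_mul_card_reducedDiffs hr hj hM (hΩ i)
        fun p hp => (mem_filter.mp (mem_filter.mp hp).1).2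
    calc (#Ω : ℝ) ≤ ((∑ i ∈ I, ∑ a ∈ offsets A, 3 * a.gcd r * #(reducedDiffs (Ωi i) r a) : ℕ) : ℝ) :=
          Nat.cast_le.mpr h1
      _ = _ := by
          push_cast
          rw [sum_product, mul_sum]
          refine sum_congr rfl fun i _ => ?_
          rw [mul_sum]
          exact sum_congr rfl fun a _ => by ring
  -- Cauchy–Schwarz with the weight `gcd(a, r)` kept in both factors.
  have hCS : (∑ x ∈ I ×ˢ offsets A, (x.2.gcd r : ℝ) * (#(reducedDiffs (Ωi x.1) r x.2) : ℝ)) ^ 2 ≤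
      (∑ x ∈ I ×ˢ offsets A, (x.2.gcd r : ℝ)) *
        ∑ x ∈ I ×ˢ offsets A, (x.2.gcd r : ℝ) * (#(reducedDiffs (Ωi x.1) r x.2) : ℝ) ^ 2 := by
    refine sum_sq_le_sum_mul_sum_of_sq_le_mul _ (fun _ _ => by positivity) (fun _ _ => by positivity)
      fun x _ => le_of_eq (by ring)
  have hI : (#I : ℝ) ≤ 3 * (M / N) := by
    have hN0 : (0 : ℝ) < N := by exact_mod_cast hN
    have h1 : (1 : ℝ) ≤ M / N := by
      rw [le_div_iff₀ hN0, one_mul]; exact_mod_cast hNM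
    have h2 : ((2 * M / N : ℕ) : ℝ) ≤ ((2 * M : ℕ) : ℝ) / N := Nat.cast_div_le
    rw [card_range]
    push_cast at h2 ⊢
    rw [mul_div_assoc] at h2
    linarith
  have hg : ∑ x ∈ I ×ˢ offsets A, (x.2.gcd r : ℝ) ≤ 3 * (M / N) * (R * (2 * A)) := by
    rw [sum_product]
    simp only
    rw [sum_const, nsmul_eq_mul]
    have h1 : ∑ a ∈ offsets A, (a.gcd r : ℝ) ≤ #r.divisors * (2 * A) := by
      exact_mod_cast sum_gcd_offsets_le A r hr
    have h2 : (#r.divisors : ℝ) ≤ R := hR r hr.ne' (Nat.le_self_pow two_ne_zero r)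
    calc _ ≤ 3 * (M / N : ℝ) * (#r.divisors * (2 * A)) := by gcongr
      _ ≤ _ := by gcongr
  have hsq : ∑ x ∈ I ×ˢ offsets A, (x.2.gcd r : ℝ) * (#(reducedDiffs (Ωi x.1) r x.2) : ℝ) ^ 2 ≤
      3 * (M / N) * (480 * R ^ 7 * (A + N * H)) := by
    rw [sum_product]
    have h1 := sum_le_card_nsmul I _ _ fun i _ =>
      sum_gcd_mul_card_reducedDiffs_sq_le hr hj (hHM.trans hM) hAr hN hH hsmall hR hharm (hΩ i)
        fun p hp p' hp' => by
          have h2 := (mem_filter.mp hp).2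
          have h3 := (mem_filter.mp hp').2
          have h4 := Nat.div_add_mod (p.1.1 + p.2.1) N
          have h5 := Nat.div_add_mod (p'.1.1 + p'.2.1) N
          rw [h2] at h4
          rw [h3] at h5
          have h6 := Nat.mod_lt (p.1.1 + p.2.1) hN
          have h7 := Nat.mod_lt (p'.1.1 + p'.2.1) hN
          rw [abs_le]
          generalize N * i = c at h4 h5
          constructor <;> omega
    rw [nsmul_eq_mul] at h1
    refine h1.trans ?_
    gcongr
  calc (#Ω : ℝ) ^ 2 ≤ (3 * ∑ x ∈ I ×ˢ offsets A,
        (x.2.gcd r : ℝ) * (#(reducedDiffs (Ωi x.1) r x.2) : ℝ)) ^ 2 :=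
        pow_le_pow_left₀ (Nat.cast_nonneg _) hcard 2
    _ ≤ 9 * ((3 * (M / N) * (R * (2 * A))) * (3 * (M / N) * (480 * R ^ 7 * (A + N * H)))) := by
        rw [mul_pow]
        norm_num only
        refine mul_le_mul_of_nonneg_left (hCS.trans ?_) (by norm_num)
        exact mul_le_mul hg hsq (sum_nonneg fun _ _ => by positivity) (by positivity)
    _ = _ := by ring

/-! ### The bound for close pairs -/

lemma card_diag_le {r j M H A : ℕ} {R : ℝ} (hr : 0 < r) (hj : r.Coprime j) (hM : M ≤ r)
    (hR : (#r.divisors : ℝ) ≤ R) :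
    (#{p ∈ closePairs r j M H A | p.1.2 = p.2.2} : ℝ) ≤ 16 * R ^ 3 * M := by
  refine le_trans (Nat.cast_le.mpr ?_) (card_sqrtPoints_le r j M R hr hj hR)
  refine card_le_card_of_injOn Prod.fst (fun p hp => ?_) fun p hp p' hp' hpp => ?_
  · exact (mem_closePairs.mp (mem_filter.mp hp).1).1.1
  · obtain ⟨h1, h2⟩ := mem_filter.mp hp
    obtain ⟨h3, h4⟩ := mem_filter.mp hp'
    refine Prod.ext hpp (eq_of_mem_sqrtPoints hj hM (mem_closePairs.mp h1).1.2
      (mem_closePairs.mp h3).1.2 ?_)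
    rw [← h2, ← h4, hpp]

/-- The number of pairs of close modular square roots of close multiples of `j`. -/
theorem card_closePairs_sq_le {r j M H A : ℕ} {R : ℝ} (hr : 0 < r) (hj : r.Coprime j)
    (hM : M ≤ r) (hH : 1 ≤ H) (hHM : H ≤ M) (hAr : A ≤ r)
    (hR : ∀ d : ℕ, d ≠ 0 → d ≤ r ^ 2 → (#d.divisors : ℝ) ≤ R)
    (hharm : ∀ n : ℕ, n ≤ r ^ 2 → ∑ i ∈ Icc 1 n, (i : ℝ)⁻¹ ≤ R) :
    (#(closePairs r j M H A) : ℝ) ^ 2 ≤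
      22000000 * R ^ 8 * (M ^ 2 + H ^ 3 * M ^ 2 * A / r + H * M * A) := by
  have hR1 : 1 ≤ R := by simpa using hR 1 one_ne_zero (pow_pos hr 2)
  have hτ : (#r.divisors : ℝ) ≤ R := hR r hr.ne' (Nat.le_self_pow two_ne_zero r)
  have hr' : (0 : ℝ) < r := by exact_mod_cast hr
  have hH' : (1 : ℝ) ≤ H := by exact_mod_cast hH
  have hHM' : (H : ℝ) ≤ M := by exact_mod_cast hHM
  have hA0 : (0 : ℝ) ≤ A := Nat.cast_nonneg A
  have hM0 : (0 : ℝ) < M := by linarith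
  set E : ℝ := H ^ 3 * M ^ 2 * A / r with hE
  have hE0 : 0 ≤ E := by positivity
  have hR68 : R ^ 6 ≤ R ^ 8 := pow_le_pow_right₀ hR1 (by norm_num)
  have hR28 : R ^ 2 ≤ R ^ 8 := pow_le_pow_right₀ hR1 (by norm_num)
  have hR8 : 0 < R ^ 8 := by positivity
  have htriv : (#(closePairs r j M H A) : ℝ) ^ 2 ≤ 2304 * R ^ 8 * (H ^ 2 * M ^ 2) := by
    calc (#(closePairs r j M H A) : ℝ) ^ 2 ≤ (48 * R ^ 3 * (H * M)) ^ 2 :=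
          pow_le_pow_left₀ (Nat.cast_nonneg _) (card_closePairs_le_mul r j M H A R hr hj hH hτ) 2
      _ = 2304 * R ^ 6 * (H ^ 2 * M ^ 2) := by ring
      _ ≤ _ := by gcongr
  have htriv' : ∀ Z : ℝ, H ^ 2 * M ^ 2 ≤ Z → Z ≤ M ^ 2 + E + H * M * A →
      (#(closePairs r j M H A) : ℝ) ^ 2 ≤ 22000000 * R ^ 8 * (M ^ 2 + E + H * M * A) := by
    intro Z h1 h2
    refine htriv.trans ?_
    have h3 : (0 : ℝ) ≤ H ^ 2 * M ^ 2 := by positivity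
    calc _ ≤ 22000000 * R ^ 8 * (H ^ 2 * M ^ 2) := by gcongr; norm_num
      _ ≤ _ := by gcongr; exact h1.trans h2
  -- If `A ≥ MH` or `AH ≥ r`, the trivial bound `H²M²` is already below one of the terms. Afterwards
  -- `A < MH` and `AH < r` are available.
  rcases le_or_gt ((M : ℝ) * H) A with hc1 | hc1
  · refine htriv' (H * M * A) ?_ ?_
    · calc (H : ℝ) ^ 2 * M ^ 2 = H * M * (M * H) := by ring
        _ ≤ _ := by gcongr
    · have : (0 : ℝ) ≤ M ^ 2 := by positivity
      linarith
  rcases le_or_gt (r : ℝ) (A * H) with hc2 | hc2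
  · refine htriv' E ?_ ?_
    · rw [hE, le_div_iff₀ hr']
      calc (H : ℝ) ^ 2 * M ^ 2 * r ≤ H ^ 2 * M ^ 2 * (A * H) := by gcongr
        _ = _ := by ring
    · have : (0 : ℝ) ≤ M ^ 2 := by positivity
      have : (0 : ℝ) ≤ H * M * A := by positivity
      linarith
  have hoff : (#{p ∈ closePairs r j M H A | p.1.2 ≠ p.2.2} : ℝ) ^ 2 ≤
      10600000 * R ^ 8 * (E + H * M * A) := by
    -- For `r ≤ 4H²` no `N ≥ 1` satisfies `4NH² < r`. But then `AH < r` forces `A ≤ 4H`, and the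
    -- trivial off-diagonal bound suffices.
    rcases le_or_gt r (4 * H ^ 2) with hc3 | hc3
    · have hc3' : (r : ℝ) ≤ 4 * H ^ 2 := by exact_mod_cast hc3
      have h1 : (#{p ∈ closePairs r j M H A | p.1.2 ≠ p.2.2} : ℝ) ≤ 18 * #r.divisors * (A * H) := by
        exact_mod_cast card_offDiag_le hr hj hM hH
      have h2 : (A : ℝ) ≤ 4 * H := by nlinarith
      have h3 : (A : ℝ) ^ 2 * H ^ 2 ≤ 16 * E := by
        rw [hE, ← mul_div_assoc, le_div_iff₀ hr']
        calc (A : ℝ) ^ 2 * H ^ 2 * r ≤ A * (4 * H) * H ^ 2 * (4 * M ^ 2) := by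
              rw [sq (A : ℝ)]
              gcongr
              exact hc3'.trans (by gcongr)
          _ = _ := by ring
      calc (#{p ∈ closePairs r j M H A | p.1.2 ≠ p.2.2} : ℝ) ^ 2 ≤ (18 * R * (A * H)) ^ 2 := by
            refine pow_le_pow_left₀ (Nat.cast_nonneg _) (h1.trans ?_) 2
            gcongr
        _ = 324 * R ^ 2 * (A ^ 2 * H ^ 2) := by ring
        _ ≤ 324 * R ^ 8 * (16 * E) := by gcongr
        _ = 5184 * R ^ 8 * E := by ring
        _ ≤ 10600000 * R ^ 8 * (E + H * M * A) := by
            have : (0 : ℝ) ≤ H * M * A := by positivity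
            gcongr
            · norm_num
            · linarith
    -- The largest `n` with `4nH² < r`. Capping it at `M` gives `N` with `M / N ≤ 1 + 8MH² / r`.
    · set n := (r - 1) / (4 * H ^ 2)
      have hH2 : 0 < 4 * H ^ 2 := by positivity
      have hn1 : 1 ≤ n := Nat.div_pos (by omega) hH2
      have hnr : n * (4 * H ^ 2) ≤ r - 1 := Nat.div_mul_le_self _ _
      have hrn : (r : ℝ) ≤ 8 * H ^ 2 * n := by
        have h1 : r - 1 < (n + 1) * (4 * H ^ 2) := (Nat.div_lt_iff_lt_mul hH2).mp (Nat.lt_succ_self n)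
        have h2 : r ≤ 8 * H ^ 2 * n := by
          have h3 : 4 * H ^ 2 * 1 ≤ 4 * H ^ 2 * n := Nat.mul_le_mul_left _ hn1
          have h4 : (n + 1) * (4 * H ^ 2) = 4 * H ^ 2 * n + 4 * H ^ 2 * 1 := by ring
          have h5 : 8 * H ^ 2 * n = 4 * H ^ 2 * n + 4 * H ^ 2 * n := by ring
          omega
        exact_mod_cast h2
      set N := min M n
      have hN1 : 1 ≤ N := le_min (hH.trans hHM) hn1
      have hsmall : 4 * N * H ^ 2 < r := by
        have h1 : N * (4 * H ^ 2) ≤ n * (4 * H ^ 2) := Nat.mul_le_mul_right _ (min_le_right _ _)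
        have h2 : 4 * N * H ^ 2 = N * (4 * H ^ 2) := by ring
        omega
      have hN0 : (0 : ℝ) < N := by exact_mod_cast hN1
      set w : ℝ := M / N with hw
      have hwN : w * N = M := div_mul_cancel₀ _ hN0.ne'
      have hw0 : 0 ≤ w := by positivity
      set y : ℝ := M * H ^ 2 / r
      have hy0 : 0 ≤ y := by positivity
      have hwy : w ≤ 1 + 8 * y := by
        rcases le_total M n with h | h
        · have : N = M := min_eq_left h
          rw [hw, this, div_self hM0.ne']
          linarith
        · have hNn : N = n := min_eq_right h
          have : w ≤ 8 * y := by
            rw [hw, hNn, ← mul_div_assoc, div_le_div_iff₀ (by exact_mod_cast hn1) hr']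
            calc (M : ℝ) * r ≤ M * (8 * H ^ 2 * n) := by gcongr
              _ = _ := by ring
          linarith
      have hmain := card_offDiag_sq_le hr hj hM hHM hAr hN1 (min_le_left _ _) hH hsmall hR hharm
      refine hmain.trans ?_
      have hyE : y * (M * A * H) = E := by
        simp only [y, hE]; field_simp
      have h1 : w * (M * A * H) ≤ M * A * H + 8 * E := by
        rw [← hyE]
        calc w * (M * A * H) ≤ (1 + 8 * y) * (M * A * H) := by gcongr
          _ = _ := by ring
      -- The quadratic term costs an extra factor `AH / r`, harmless because `AH < r`.
      have hyA : y ^ 2 * A ^ 2 ≤ E := by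
        have h2 : y ^ 2 * A ^ 2 = E * (A * H / r) := by
          simp only [y, hE]; field_simp
        rw [h2]
        exact mul_le_of_le_one_right hE0 ((div_le_one hr').mpr hc2.le)
      have h3 : w ^ 2 * A ^ 2 ≤ 2 * (M * A * H) + 128 * E := by
        calc w ^ 2 * A ^ 2 ≤ (1 + 8 * y) ^ 2 * A ^ 2 := by gcongr
          _ ≤ (2 + 128 * y ^ 2) * A ^ 2 := by
              gcongr
              nlinarith [sq_nonneg (1 - 8 * y)]
          _ = 2 * (A * A) + 128 * (y ^ 2 * A ^ 2) := by ring
          _ ≤ 2 * (M * H * A) + 128 * E := by gcongr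
          _ = _ := by ring
      have h4 : w ^ 2 * (A ^ 2 + A * H * N) = w ^ 2 * A ^ 2 + w * (M * A * H) := by
        rw [← hwN]; ring
      rw [h4]
      have h5 : (0 : ℝ) ≤ M * A * H := by positivity
      calc 77760 * R ^ 8 * (w ^ 2 * A ^ 2 + w * (M * A * H))
          ≤ 77760 * R ^ 8 * (136 * (E + H * M * A)) := by gcongr; linarith
        _ = 10575360 * R ^ 8 * (E + H * M * A) := by ring
        _ ≤ _ := by
            have : (0 : ℝ) ≤ E + H * M * A := by positivity
            gcongr; norm_num
  have hdiag := card_diag_le (H := H) (A := A) hr hj hM hτ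
  have hsplit : (#(closePairs r j M H A) : ℝ) = #{p ∈ closePairs r j M H A | p.1.2 = p.2.2} +
      #{p ∈ closePairs r j M H A | p.1.2 ≠ p.2.2} := by
    exact_mod_cast (card_filter_add_card_filter_not (s := closePairs r j M H A) (fun p => p.1.2 = p.2.2)).symm
  have hx0 : (0 : ℝ) ≤ #{p ∈ closePairs r j M H A | p.1.2 = p.2.2} := Nat.cast_nonneg _
  generalize Nat.cast (R := ℝ) #{p ∈ closePairs r j M H A | p.1.2 = p.2.2} = x at *
  generalize Nat.cast (R := ℝ) #{p ∈ closePairs r j M H A | p.1.2 ≠ p.2.2} = z at *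
  have hx2 : x ^ 2 ≤ 256 * R ^ 8 * M ^ 2 := by
    calc x ^ 2 ≤ (16 * R ^ 3 * M) ^ 2 := pow_le_pow_left₀ hx0 hdiag 2
      _ = 256 * R ^ 6 * M ^ 2 := by ring
      _ ≤ _ := by gcongr
  rw [hsplit]
  have h1 : (0 : ℝ) ≤ R ^ 8 * M ^ 2 := by positivity
  have h2 : (0 : ℝ) ≤ R ^ 8 * (E + H * M * A) := by positivity
  calc (x + z) ^ 2 ≤ 2 * (x ^ 2 + z ^ 2) := add_sq_le
    _ ≤ 2 * (256 * R ^ 8 * M ^ 2 + 10600000 * R ^ 8 * (E + H * M * A)) := by gcongr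
    _ ≤ _ := by linarith

/-! ### Additive characters, the Dirichlet kernel and mean squares -/

lemma expChar_eq_exp (x : ℝ) : expChar x = Complex.exp (Complex.I * (2 * Real.pi * x : ℝ)) := by
  rw [expChar]
  congr 1
  push_cast
  ring

lemma norm_expChar (x : ℝ) : ‖expChar x‖ = 1 := by
  rw [expChar_eq_exp, mul_comm, Complex.norm_exp_ofReal_mul_I]

lemma expChar_add (x y : ℝ) : expChar (x + y) = expChar x * expChar y := by
  simp only [expChar, ← Complex.exp_add]
  congr 1
  push_cast
  ring

lemma expChar_sub (x y : ℝ) : expChar (x - y) = expChar x * (starRingEnd ℂ) (expChar y) := by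
  rw [expChar_eq_exp, expChar_eq_exp, expChar_eq_exp, ← Complex.exp_conj, map_mul, Complex.conj_I,
    Complex.conj_ofReal, ← Complex.exp_add]
  congr 1
  push_cast
  ring

lemma expChar_natCast_mul (n : ℕ) (x : ℝ) : expChar (n * x) = expChar x ^ n := by
  rw [expChar, expChar, ← Complex.exp_nat_mul]
  congr 1
  push_cast
  ring

/-- `|e(θ) - 1| ≥ 4 ‖θ‖`. -/
lemma four_mul_le_norm_expChar_sub_one (θ η : ℝ) (h : ∀ n : ℤ, η ≤ |θ - n|) :
    4 * η ≤ ‖expChar θ - 1‖ := by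
  rw [expChar_eq_exp, Complex.norm_exp_I_mul_ofReal_sub_one]
  set δ := θ - round θ with hδ
  have hδ1 : |δ| ≤ 1 / 2 := abs_sub_round θ
  have hsin : |Real.sin (2 * Real.pi * θ / 2)| = |Real.sin (Real.pi * δ)| := by
    have : 2 * Real.pi * θ / 2 = Real.pi * δ + (round θ : ℤ) * Real.pi := by rw [hδ]; ring
    rw [this, Real.sin_add_int_mul_pi, abs_mul]
    simp
  have hle : 2 * |δ| ≤ |Real.sin (Real.pi * δ)| := by
    have h1 := Real.mul_le_sin (x := Real.pi * |δ|) (by positivity)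
      (by nlinarith [Real.pi_pos])
    have h2 : |Real.sin (Real.pi * δ)| = |Real.sin (Real.pi * |δ|)| := by
      rcases abs_choice δ with h | h <;> rw [h]
      rw [mul_neg, Real.sin_neg, abs_neg]
    rw [h2]
    refine le_trans ?_ (le_abs_self _)
    calc 2 * |δ| = 2 / Real.pi * (Real.pi * |δ|) := by field_simp
      _ ≤ _ := h1
  rw [norm_mul, Real.norm_eq_abs, Real.norm_eq_abs, abs_two, hsin]
  linarith [h (round θ)]

/-- Shifting `l` by `Q` only introduces a unimodular factor. -/
lemma norm_sum_expChar_le (Q : ℕ) (θ : ℝ) :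
    ‖∑ l ∈ Icc (-Q : ℤ) Q, expChar (l * θ)‖ = ‖∑ i ∈ range (2 * Q + 1), expChar θ ^ i‖ := by
  have h1 : ∑ l ∈ Icc (-Q : ℤ) Q, expChar (l * θ) =
      ∑ i ∈ range (2 * Q + 1), expChar (-(Q * θ)) * expChar θ ^ i := by
    refine sum_bij' (fun l _ => (l + Q).toNat) (fun i _ => (i : ℤ) - Q) ?_ ?_ ?_ ?_ ?_
    · intro l hl
      rw [mem_Icc] at hl
      rw [mem_range]
      omega
    · intro i hi
      rw [mem_range] at hi
      rw [mem_Icc]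
      omega
    · intro l hl
      rw [mem_Icc] at hl
      omega
    · intro i _
      omega
    · intro l hl
      rw [mem_Icc] at hl
      rw [← expChar_natCast_mul, ← expChar_add]
      congr 1
      have : (((l + Q).toNat : ℕ) : ℝ) = l + Q := by
        have h2 : (((l + Q).toNat : ℕ) : ℤ) = l + Q := Int.toNat_of_nonneg (by omega)
        exact_mod_cast h2
      rw [this]
      ring
  rw [h1, ← mul_sum, norm_mul, norm_expChar, one_mul]

/-- The Dirichlet kernel of length `Q` at a point near `d / Q`. -/
lemma norm_sum_expChar_le_of_near (Q : ℕ) (a b : ℕ) (ha : a < Q) (hb : b < Q) (θ : ℝ)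
    (hθ : |θ - ((a : ℝ) - b) / Q| ≤ 2 / Q) :
    ‖∑ l ∈ Icc (-Q : ℤ) Q, expChar (l * θ)‖ ≤
      12 * Q * (((Nat.dist a b + 1 : ℕ) : ℝ)⁻¹ + ((Q - Nat.dist a b + 1 : ℕ) : ℝ)⁻¹) := by
  rw [norm_sum_expChar_le]
  have hQ0 : (0 : ℝ) < Q := by exact_mod_cast (by omega : 0 < Q)
  have hQ1 : (1 : ℝ) ≤ Q := by exact_mod_cast (by omega : 1 ≤ Q)
  set d := Nat.dist a b with hd
  have hdQ : d < Q := by rw [hd, Nat.dist]; omega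
  have htriv : ‖∑ i ∈ range (2 * Q + 1), expChar θ ^ i‖ ≤ 3 * Q := by
    refine (norm_sum_le _ _).trans ?_
    simp only [norm_pow, norm_expChar, one_pow, sum_const, card_range, nsmul_eq_mul, mul_one]
    push_cast
    linarith
  have hquarter : ∀ n : ℕ, n ≤ 3 → (1 / 4 : ℝ) ≤ ((n + 1 : ℕ) : ℝ)⁻¹ := by
    intro n hn
    rw [one_div]
    gcongr
    exact_mod_cast (by omega : n + 1 ≤ 4)
  -- When `d` or `Q - d` is at most `3`, the error `2 / Q` may bring `θ` to an integer, but there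
  -- the trivial bound `3Q` is enough. Both distances occur because the frequencies live on a
  -- circle.
  rcases le_or_gt d 3 with h3 | h3
  · refine htriv.trans ?_
    have h1 := hquarter d h3
    have h2 : (0 : ℝ) ≤ ((Q - d + 1 : ℕ) : ℝ)⁻¹ := by positivity
    calc (3 : ℝ) * Q = 12 * Q * (1 / 4 + 0) := by ring
      _ ≤ _ := by gcongr
  rcases le_or_gt (Q - d) 3 with h4 | h4
  · refine htriv.trans ?_
    have h1 := hquarter (Q - d) h4
    have h2 : (0 : ℝ) ≤ ((d + 1 : ℕ) : ℝ)⁻¹ := by positivity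
    calc (3 : ℝ) * Q = 12 * Q * (0 + 1 / 4) := by ring
      _ ≤ _ := by gcongr
  set c := min d (Q - d) with hc
  have hc4 : 4 ≤ c := le_min h3 h4
  have hc4' : (4 : ℝ) ≤ c := by exact_mod_cast hc4
  -- `(a - b) / Q` is at least `c / Q` away from every integer; as `c ≥ 4`, the error `2 / Q` uses
  -- up at most half of this.
  have hη : ∀ n : ℤ, (c : ℝ) / (2 * Q) ≤ |θ - n| := by
    intro n
    have h1 : (c : ℤ) ≤ |(a : ℤ) - b - n * Q| := by
      have hda : (d : ℤ) = |(a : ℤ) - b| := by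
        rw [hd, Nat.dist]
        rcases le_total a b with h | h
        · rw [abs_of_nonpos (by omega)]; omega
        · rw [abs_of_nonneg (by omega)]; omega
      have hcd : (c : ℤ) ≤ d := by omega
      have hcQ : (c : ℤ) ≤ Q - d := by omega
      rcases eq_or_ne n 0 with rfl | hn
      · simpa [← hda] using hcd
      · have h2 : (Q : ℤ) ≤ |n * Q| := by
          rw [abs_mul, Nat.abs_cast]
          have : 1 ≤ |n| := Int.one_le_abs hn
          nlinarith
        have h3 := abs_sub_abs_le_abs_sub (n * Q : ℤ) ((a : ℤ) - b)
        rw [abs_sub_comm (n * Q : ℤ)] at h3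
        linarith
    have h1' : (c : ℝ) ≤ |(a : ℝ) - b - n * Q| := by exact_mod_cast h1
    have h2 : (c : ℝ) / Q ≤ |((a : ℝ) - b) / Q - n| := by
      rw [div_le_iff₀ hQ0, ← abs_of_pos hQ0, ← abs_mul, abs_of_pos hQ0, sub_mul,
        div_mul_cancel₀ _ hQ0.ne']
      exact h1'
    have h5 : |((a : ℝ) - b) / Q - n| ≤ |θ - n| + |θ - ((a : ℝ) - b) / Q| := by
      have := abs_sub (θ - n) (θ - ((a : ℝ) - b) / Q)
      rwa [show θ - n - (θ - ((a : ℝ) - b) / Q) = ((a : ℝ) - b) / Q - n by ring] at this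
    have h6 : (c : ℝ) / (2 * Q) = c / Q - (c / 2) / Q := by ring
    have h7 : 2 / (Q : ℝ) ≤ (c / 2) / Q := by gcongr; linarith
    linarith
  have hz := four_mul_le_norm_expChar_sub_one θ _ hη
  have hgeom : ‖∑ i ∈ range (2 * Q + 1), expChar θ ^ i‖ * ‖expChar θ - 1‖ ≤ 2 := by
    rw [← norm_mul, geom_sum_mul]
    refine (norm_sub_le _ _).trans ?_
    rw [norm_pow, norm_expChar]
    norm_num
  have hc0 : (0 : ℝ) < c := by linarith
  have hle : ‖∑ i ∈ range (2 * Q + 1), expChar θ ^ i‖ ≤ Q * (c : ℝ)⁻¹ := by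
    have h1 : ‖∑ i ∈ range (2 * Q + 1), expChar θ ^ i‖ * (4 * (c / (2 * Q))) ≤ 2 :=
      (mul_le_mul_of_nonneg_left hz (norm_nonneg _)).trans hgeom
    rw [← div_eq_mul_inv, le_div_iff₀ hc0]
    have h2 : ‖∑ i ∈ range (2 * Q + 1), expChar θ ^ i‖ * (4 * (c / (2 * Q))) * Q =
        2 * (‖∑ i ∈ range (2 * Q + 1), expChar θ ^ i‖ * c) := by field_simp; ring
    nlinarith
  refine hle.trans ?_
  have hinv : ∀ n : ℕ, c = n → (c : ℝ)⁻¹ ≤ 12 * ((n + 1 : ℕ) : ℝ)⁻¹ := by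
    intro n hn
    rw [← hn, ← div_eq_mul_inv, ← one_div, div_le_div_iff₀ hc0 (by positivity)]
    push_cast
    linarith
  have hp1 : (0 : ℝ) ≤ ((d + 1 : ℕ) : ℝ)⁻¹ := by positivity
  have hp2 : (0 : ℝ) ≤ ((Q - d + 1 : ℕ) : ℝ)⁻¹ := by positivity
  have hfin : (c : ℝ)⁻¹ ≤ 12 * (((d + 1 : ℕ) : ℝ)⁻¹ + ((Q - d + 1 : ℕ) : ℝ)⁻¹) := by
    rcases min_choice d (Q - d) with h | h
    · linarith [hinv d h]
    · linarith [hinv (Q - d) h]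
  calc _ ≤ Q * (12 * (((d + 1 : ℕ) : ℝ)⁻¹ + ((Q - d + 1 : ℕ) : ℝ)⁻¹)) := by gcongr
    _ = _ := by ring

lemma sum_range_dist_le (Q a : ℕ) (ha : a < Q) (g : ℕ → ℝ) (hg : ∀ n, 0 ≤ g n) :
    ∑ b ∈ range Q, g (Nat.dist a b) ≤ 2 * ∑ d ∈ range Q, g d := by
  rw [← sum_fiberwise_of_maps_to (t := range Q) (g := fun b => Nat.dist a b), mul_sum]
  · refine sum_le_sum fun d _ => ?_
    rw [sum_congr rfl (g := fun _ => g d) fun b hb => by rw [(mem_filter.mp hb).2], sum_const,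
      nsmul_eq_mul]
    refine mul_le_mul_of_nonneg_right ?_ (hg d)
    have : {b ∈ range Q | Nat.dist a b = d} ⊆ {a - d, a + d} := by
      intro b hb
      have h := (mem_filter.mp hb).2
      rw [Nat.dist] at h
      rw [mem_insert, mem_singleton]
      omega
    exact_mod_cast (card_le_card this).trans card_le_two
  · intro b hb
    have h := mem_range.mp hb
    refine mem_range.mpr ?_
    simp only [Nat.dist]
    omega

lemma sum_kernel_weight_le (Q a : ℕ) (ha : a < Q) :
    ∑ b ∈ range Q, 12 * Q * (((Nat.dist a b + 1 : ℕ) : ℝ)⁻¹ + ((Q - Nat.dist a b + 1 : ℕ) : ℝ)⁻¹) ≤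
      48 * Q * ∑ i ∈ Icc 1 Q, (i : ℝ)⁻¹ := by
  have hH : ∑ d ∈ range Q, ((d + 1 : ℕ) : ℝ)⁻¹ = ∑ i ∈ Icc 1 Q, (i : ℝ)⁻¹ := by
    rw [sum_range fun d => ((d + 1 : ℕ) : ℝ)⁻¹]
    rw [← sum_range fun d => ((d + 1 : ℕ) : ℝ)⁻¹, range_eq_Ico,
      sum_Ico_add' (fun d : ℕ => (d : ℝ)⁻¹) 0 Q 1]
    rfl
  have hH' : ∑ d ∈ range Q, ((Q - d + 1 : ℕ) : ℝ)⁻¹ ≤ ∑ i ∈ Icc 1 Q, (i : ℝ)⁻¹ := by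
    rw [← hH, ← sum_range_reflect]
    refine sum_le_sum fun d hd => ?_
    rw [mem_range] at hd
    gcongr
    omega
  rw [← mul_sum, sum_add_distrib]
  have h1 := sum_range_dist_le Q a ha (fun d => ((d + 1 : ℕ) : ℝ)⁻¹) fun _ => by positivity
  have h2 := sum_range_dist_le Q a ha (fun d => ((Q - d + 1 : ℕ) : ℝ)⁻¹) fun _ => by positivity
  calc _ ≤ 12 * (Q : ℝ) * (2 * ∑ i ∈ Icc 1 Q, (i : ℝ)⁻¹ + 2 * ∑ i ∈ Icc 1 Q, (i : ℝ)⁻¹) := by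
        gcongr
        · exact h1.trans (by rw [hH])
        · exact h2.trans (by gcongr)
    _ = _ := by ring

/-- Mean square of a trigonometric polynomial whose frequencies `θ x` are near `b x / Q`. -/
lemma sum_norm_sq_sum_expChar_le {ι : Type*} (X : Finset ι) (c : ι → ℂ) (θ : ι → ℝ) (b : ι → ℕ)
    (Q : ℕ) (B : ℝ) (hB : 0 ≤ B) (hb : ∀ x ∈ X, b x < Q) (hc : ∀ x ∈ X, ‖c x‖ ≤ B)
    (hθ : ∀ x ∈ X, ∀ y ∈ X, |θ x - θ y - ((b x : ℝ) - b y) / Q| ≤ 2 / Q) :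
    ∑ l ∈ Icc (-Q : ℤ) Q, ‖∑ x ∈ X, c x * expChar (l * θ x)‖ ^ 2 ≤
      B ^ 2 * (48 * Q * ∑ i ∈ Icc 1 Q, (i : ℝ)⁻¹) *
        ∑ i ∈ range Q, (#{x ∈ X | b x = i} : ℝ) ^ 2 := by
  set W : ℕ → ℕ → ℝ := fun i i' =>
    12 * Q * (((Nat.dist i i' + 1 : ℕ) : ℝ)⁻¹ + ((Q - Nat.dist i i' + 1 : ℕ) : ℝ)⁻¹) with hW
  have hW0 : ∀ i i', 0 ≤ W i i' := fun i i' => by simp only [hW]; positivity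
  have hWsymm : ∀ i i', W i i' = W i' i := fun i i' => by simp only [hW, Nat.dist_comm i i']
  set n : ℕ → ℝ := fun i => #{x ∈ X | b x = i} with hn
  have hexpand : ∑ l ∈ Icc (-Q : ℤ) Q, ‖∑ x ∈ X, c x * expChar (l * θ x)‖ ^ 2 ≤
      ∑ x ∈ X, ∑ y ∈ X, B ^ 2 * W (b x) (b y) := by
    have h1 : ((∑ l ∈ Icc (-Q : ℤ) Q, ‖∑ x ∈ X, c x * expChar (l * θ x)‖ ^ 2 : ℝ) : ℂ) =
        ∑ x ∈ X, ∑ y ∈ X, c x * (starRingEnd ℂ) (c y) *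
          ∑ l ∈ Icc (-Q : ℤ) Q, expChar (l * (θ x - θ y)) := by
      push_cast
      simp only [← Complex.mul_conj', map_sum, map_mul, sum_mul_sum]
      rw [sum_comm]
      refine sum_congr rfl fun x _ => ?_
      rw [sum_comm]
      refine sum_congr rfl fun y _ => ?_
      rw [mul_sum]
      refine sum_congr rfl fun l _ => ?_
      rw [mul_sub, expChar_sub]
      ring
    have h2 : 0 ≤ ∑ l ∈ Icc (-Q : ℤ) Q, ‖∑ x ∈ X, c x * expChar (l * θ x)‖ ^ 2 :=
      sum_nonneg fun _ _ => by positivity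
    rw [← abs_of_nonneg h2, ← Real.norm_eq_abs, ← Complex.norm_real, h1]
    refine (norm_sum_le _ _).trans (sum_le_sum fun x hx => (norm_sum_le _ _).trans
      (sum_le_sum fun y hy => ?_))
    rw [norm_mul, norm_mul, RCLike.norm_conj, sq]
    have h3 := norm_sum_expChar_le_of_near Q (b x) (b y) (hb x hx) (hb y hy) _ (hθ x hx y hy)
    exact mul_le_mul (mul_le_mul (hc x hx) (hc y hy) (norm_nonneg _) hB) h3 (norm_nonneg _)
      (mul_nonneg hB hB)
  have hfib : ∀ F : ℕ → ℝ, ∑ x ∈ X, F (b x) = ∑ i ∈ range Q, n i * F i := by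
    intro F
    rw [← sum_fiberwise_of_maps_to (t := range Q) (g := b) fun x hx => mem_range.mpr (hb x hx)]
    refine sum_congr rfl fun i _ => ?_
    rw [sum_congr rfl (g := fun _ => F i) fun x hx => by rw [(mem_filter.mp hx).2], sum_const,
      nsmul_eq_mul]
  have hdouble : ∑ x ∈ X, ∑ y ∈ X, W (b x) (b y) =
      ∑ i ∈ range Q, ∑ i' ∈ range Q, n i * n i' * W i i' := by
    rw [hfib fun i => ∑ y ∈ X, W i (b y)]
    refine sum_congr rfl fun i _ => ?_
    rw [hfib (W i), mul_sum]
    exact sum_congr rfl fun i' _ => by ring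
  -- Schur's test: the kernel is symmetric, so `n n' ≤ (n² + n'²) / 2` reduces the form to its row
  -- sums.
  have hschur : ∑ i ∈ range Q, ∑ i' ∈ range Q, n i * n i' * W i i' ≤
      ∑ i ∈ range Q, n i ^ 2 * ∑ i' ∈ range Q, W i i' := by
    have h1 : ∑ i ∈ range Q, ∑ i' ∈ range Q, n i' ^ 2 * W i i' =
        ∑ i ∈ range Q, n i ^ 2 * ∑ i' ∈ range Q, W i i' := by
      rw [sum_comm]
      refine sum_congr rfl fun i _ => ?_
      rw [mul_sum]
      exact sum_congr rfl fun i' _ => by rw [hWsymm]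
    have h2 : ∑ i ∈ range Q, ∑ i' ∈ range Q, n i * n i' * W i i' ≤
        ∑ i ∈ range Q, ∑ i' ∈ range Q, (n i ^ 2 * W i i' + n i' ^ 2 * W i i') / 2 := by
      refine sum_le_sum fun i _ => sum_le_sum fun i' _ => ?_
      have := mul_nonneg (sq_nonneg (n i - n i')) (hW0 i i')
      linarith
    simp only [← sum_div, sum_add_distrib] at h2
    rw [h1] at h2
    simp only [← mul_sum] at h2
    linarith
  calc _ ≤ ∑ x ∈ X, ∑ y ∈ X, B ^ 2 * W (b x) (b y) := hexpand
    _ = B ^ 2 * ∑ x ∈ X, ∑ y ∈ X, W (b x) (b y) := by simp only [mul_sum]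
    _ ≤ B ^ 2 * ∑ i ∈ range Q, n i ^ 2 * ∑ i' ∈ range Q, W i i' := by
        rw [hdouble]
        gcongr
    _ ≤ B ^ 2 * ∑ i ∈ range Q, n i ^ 2 * (48 * Q * ∑ i ∈ Icc 1 Q, (i : ℝ)⁻¹) := by
        refine mul_le_mul_of_nonneg_left (sum_le_sum fun i hi => ?_) (sq_nonneg B)
        exact mul_le_mul_of_nonneg_left (sum_kernel_weight_le Q i (mem_range.mp hi)) (sq_nonneg _)
    _ = _ := by
        rw [← sum_mul]
        ring

/-! ### From the bilinear sum to close pairs -/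

lemma bilinearSum_eq (r j : ℕ) (L M : ℝ) (α : ℤ → ℂ) (β : ℕ → ℂ) (f : ℝ → ℝ) :
    bilinearSum r j L M α β f = ∑ l ∈ lRange L, α l *
      ∑ x ∈ sqrtPoints r j ⌊M⌋₊, β x.1 * expChar (l * ((x.2 : ℝ) / r + f x.1)) := by
  rw [bilinearSum]
  refine sum_congr rfl fun l _ => ?_
  rw [← sum_fiberwise_of_maps_to (t := mRange M) (g := Prod.fst)
    fun x hx => (mem_sqrtPoints.mp hx).1, mul_sum]
  refine sum_congr rfl fun m hm => ?_
  rw [mul_sum]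
  symm
  refine sum_bij (fun x _ => x.2) (fun x hx => ?_) (fun x hx y hy hxy => ?_) (fun k hk => ?_) ?_
  · obtain ⟨h1, rfl⟩ := mem_filter.mp hx
    exact (mem_sqrtPoints.mp h1).2
  · exact Prod.ext ((mem_filter.mp hx).2.trans (mem_filter.mp hy).2.symm) hxy
  · exact ⟨(m, k), mem_filter.mpr ⟨mem_sqrtPoints.mpr ⟨hm, hk⟩, rfl⟩, rfl⟩
  · intro x hx
    obtain ⟨-, rfl⟩ := mem_filter.mp hx
    rw [mul_add, expChar_add, mul_div_assoc]
    ring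

lemma norm_le_supNorm {M : ℝ} (β : ℕ → ℂ) {m : ℕ} (hm : m ∈ mRange M) : ‖β m‖ ≤ supNorm M β := by
  have h := le_sup (f := fun m => ‖β m‖₊) hm
  exact_mod_cast NNReal.coe_le_coe.mpr h

lemma supNorm_nonneg (M : ℝ) (β : ℕ → ℂ) : 0 ≤ supNorm M β := NNReal.coe_nonneg _

/-- Points in the same cell of length `r / Q` and the same block of length `H` form close pairs. -/
lemma sum_card_cell_sq_le (r j M H Q : ℕ) (hH : 0 < H) (hQ : 0 < Q) :
    ∑ b ∈ range (M / H + 1), ∑ i ∈ range Q,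
      #{x ∈ {x ∈ sqrtPoints r j M | x.1 / H = b} | x.2 * Q / r = i} ^ 2 ≤
        #(closePairs r j M H (r / Q)) := by
  -- Each squared cell count is the size of the set `C s` of ordered pairs in that cell, and these
  -- sets are disjoint.
  set U := sqrtPoints r j M
  set C : ℕ × ℕ → Finset ((ℕ × ℕ) × (ℕ × ℕ)) := fun s =>
    {x ∈ {x ∈ U | x.1 / H = s.1} | x.2 * Q / r = s.2} ×ˢ
      {x ∈ {x ∈ U | x.1 / H = s.1} | x.2 * Q / r = s.2} with hC
  have hmem : ∀ s p, p ∈ C s → (p.1 ∈ U ∧ p.1.1 / H = s.1 ∧ p.1.2 * Q / r = s.2) ∧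
      (p.2 ∈ U ∧ p.2.1 / H = s.1 ∧ p.2.2 * Q / r = s.2) := by
    intro s p hp
    simp only [hC, mem_product, mem_filter] at hp
    tauto
  have hdisj : ∀ s ∈ range (M / H + 1) ×ˢ range Q, ∀ t ∈ range (M / H + 1) ×ˢ range Q, s ≠ t →
      Disjoint (C s) (C t) := by
    intro s _ t _ hst
    rw [disjoint_left]
    intro p hps hpt
    obtain ⟨⟨-, h1, h2⟩, -⟩ := hmem s p hps
    obtain ⟨⟨-, h3, h4⟩, -⟩ := hmem t p hpt
    exact hst (Prod.ext (h1.symm.trans h3) (h2.symm.trans h4))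
  rw [← sum_product' (f := fun b i =>
    #{x ∈ {x ∈ U | x.1 / H = b} | x.2 * Q / r = i} ^ 2)]
  calc _ = ∑ s ∈ range (M / H + 1) ×ˢ range Q, #(C s) :=
        sum_congr rfl fun s _ => by rw [hC, card_product, sq]
    _ = #((range (M / H + 1) ×ˢ range Q).biUnion C) := (card_biUnion hdisj).symm
    _ ≤ _ := by
        refine card_le_card fun p hp => ?_
        obtain ⟨s, -, hps⟩ := mem_biUnion.mp hp
        obtain ⟨⟨h1, h2, h3⟩, h4, h5, h6⟩ := hmem s p hps
        refine mem_closePairs.mpr ⟨⟨h1, h4⟩, ?_, ?_⟩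
        · have e1 := Nat.div_add_mod p.1.1 H
          have e2 := Nat.div_add_mod p.2.1 H
          rw [h2] at e1
          rw [h5] at e2
          have l1 := Nat.mod_lt p.1.1 hH
          have l2 := Nat.mod_lt p.2.1 hH
          generalize H * s.1 = c at e1 e2
          rw [abs_le]
          constructor <;> omega
        · have hr : 0 < r := by
            have := mem_range.mp (mem_filter.mp (mem_sqrtPoints.mp h1).2).1
            omega
          have e1 := Nat.div_add_mod (p.1.2 * Q) r
          have e2 := Nat.div_add_mod (p.2.2 * Q) r
          rw [h3] at e1
          rw [h6] at e2
          have l1 := Nat.mod_lt (p.1.2 * Q) hr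
          have l2 := Nat.mod_lt (p.2.2 * Q) hr
          have hQ' : (0 : ℤ) < Q := by exact_mod_cast hQ
          push_cast
          rw [Int.le_ediv_iff_mul_le hQ', ← abs_of_pos hQ', ← abs_mul, sub_mul]
          generalize r * s.2 = c at e1 e2
          have e1' : (p.1.2 : ℤ) * Q = c + (p.1.2 * Q % r : ℕ) := by exact_mod_cast e1.symm
          have e2' : (p.2.2 : ℤ) * Q = c + (p.2.2 * Q % r : ℕ) := by exact_mod_cast e2.symm
          rw [e1', e2', abs_le]
          constructor <;> omega

lemma abs_sub_le_of_derivWithin_le {M F : ℝ} {f : ℝ → ℝ}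
    (hf : ContDiffOn ℝ 1 f (Set.Icc 1 M))
    (hf' : ∀ x ∈ Set.Icc 1 M, |derivWithin f (Set.Icc 1 M) x| ≤ F) {x y : ℝ}
    (hx : x ∈ Set.Icc 1 M) (hy : y ∈ Set.Icc 1 M) : |f x - f y| ≤ F * |x - y| :=
  (convex_Icc 1 M).norm_image_sub_le_of_norm_derivWithin_le (hf.differentiableOn one_ne_zero) hf' hy hx

/-- Rounding `k / r` down to a multiple of `1 / Q` leaves a remainder in `[0, 1/Q)`, so two
remainders differ by at most `1 / Q`. -/
lemma abs_div_sub_div_sub_le (r Q k k' : ℕ) (hr : 0 < r) (hQ : 0 < Q) :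
    |(k : ℝ) / r - k' / r - (((k * Q / r : ℕ) : ℝ) - (k' * Q / r : ℕ)) / Q| ≤ 1 / Q := by
  have hr' : (0 : ℝ) < r := by exact_mod_cast hr
  have hQ' : (0 : ℝ) < Q := by exact_mod_cast hQ
  have key : ∀ k : ℕ, (k : ℝ) / r = (k * Q / r : ℕ) / Q + ((k * Q % r : ℕ) : ℝ) / (r * Q) := by
    intro k
    have h : (r : ℝ) * (k * Q / r : ℕ) + (k * Q % r : ℕ) = k * Q := by
      exact_mod_cast Nat.div_add_mod (k * Q) r
    field_simp
    linarith
  have hlt : ∀ k : ℕ, ((k * Q % r : ℕ) : ℝ) ≤ r := fun k => by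
    exact_mod_cast (Nat.mod_lt (k * Q) hr).le
  rw [key k, key k']
  have e : ((k * Q / r : ℕ) : ℝ) / Q + ((k * Q % r : ℕ) : ℝ) / (r * Q) -
      ((k' * Q / r : ℕ) / Q + ((k' * Q % r : ℕ) : ℝ) / (r * Q)) -
      (((k * Q / r : ℕ) : ℝ) - (k' * Q / r : ℕ)) / Q =
      (((k * Q % r : ℕ) : ℝ) - (k' * Q % r : ℕ)) / (r * Q) := by ring
  rw [e, abs_div, abs_of_pos (mul_pos hr' hQ'), div_le_div_iff₀ (mul_pos hr' hQ') hQ', one_mul]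
  refine mul_le_mul_of_nonneg_right (abs_le.mpr ⟨?_, ?_⟩) hQ'.le
  · have := hlt k'
    have : (0 : ℝ) ≤ (k * Q % r : ℕ) := Nat.cast_nonneg _
    linarith
  · have := hlt k
    have : (0 : ℝ) ≤ (k' * Q % r : ℕ) := Nat.cast_nonneg _
    linarith

/-- The sum over `m` and `k` in the bilinear sum has small mean square if there are few close pairs
of modular square roots. -/
lemma sum_norm_sq_le_card_closePairs (r j : ℕ) (L M F : ℝ) (H : ℕ) (f : ℝ → ℝ) (β : ℕ → ℂ)
    (hr : 0 < r) (hL : 1 ≤ L) (hM : 1 ≤ M) (hf : ContDiffOn ℝ 1 f (Set.Icc 1 M))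
    (hf' : ∀ x ∈ Set.Icc 1 M, |derivWithin f (Set.Icc 1 M) x| ≤ F)
    (hH : 1 ≤ H) (hHF : (H : ℝ) * (L * F) ≤ 1) (hHM : (H : ℝ) ≤ M) :
    ∑ l ∈ lRange L,
      ‖∑ x ∈ sqrtPoints r j ⌊M⌋₊, β x.1 * expChar (l * ((x.2 : ℝ) / r + f x.1))‖ ^ 2 ≤
      2 * ⌊M⌋₊ / H * (supNorm M β ^ 2 * (48 * ⌊L⌋₊ * ∑ i ∈ Icc 1 ⌊L⌋₊, (i : ℝ)⁻¹)) *
        #(closePairs r j ⌊M⌋₊ H (r / ⌊L⌋₊)) := by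
  have hMmem := fun m => mem_mRange (M := M) (by linarith) (m := m)
  have hmR : mRange M = Icc 1 ⌊M⌋₊ := rfl
  have hLR : lRange L = Icc (-(⌊L⌋₊ : ℤ)) ⌊L⌋₊ := by
    rw [lRange, Int.natCast_floor_eq_floor (by linarith)]
  set Q := ⌊L⌋₊ with hQdef
  set M' := ⌊M⌋₊
  set U := sqrtPoints r j M'
  set B := supNorm M β
  have hB : 0 ≤ B := supNorm_nonneg M β
  have hQ : 0 < Q := Nat.floor_pos.mpr hL
  have hQL : (Q : ℝ) ≤ L := Nat.floor_le (by linarith)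
  have hQ' : (0 : ℝ) < Q := by exact_mod_cast hQ
  have hHM' : H ≤ M' := Nat.le_floor hHM
  have hF : 0 ≤ F := (abs_nonneg _).trans (hf' 1 ⟨le_rfl, hM⟩)
  -- The role of `H ≤ 1 / (LF)`: across a block, `f` moves a frequency by at most one cell width.
  have hHF' : F * H ≤ 1 / Q := by
    rw [le_div_iff₀ hQ']
    calc F * H * Q ≤ F * H * L := by gcongr
      _ = H * (L * F) := by ring
      _ ≤ 1 := hHF
  have hblock : ∀ b ∈ range (M' / H + 1),
      ∑ l ∈ Icc (-Q : ℤ) Q,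
        ‖∑ x ∈ {x ∈ U | x.1 / H = b}, β x.1 * expChar (l * ((x.2 : ℝ) / r + f x.1))‖ ^ 2 ≤
        B ^ 2 * (48 * Q * ∑ i ∈ Icc 1 Q, (i : ℝ)⁻¹) *
          ∑ i ∈ range Q, (#{x ∈ {x ∈ U | x.1 / H = b} | x.2 * Q / r = i} : ℝ) ^ 2 := by
    intro b _
    refine sum_norm_sq_sum_expChar_le _ (fun x : ℕ × ℕ => β x.1) (fun x => (x.2 : ℝ) / r + f x.1)
      (fun x => x.2 * Q / r) Q B hB (fun x hx => ?_) (fun x hx => ?_) fun x hx y hy => ?_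
    · have := mem_range.mp (mem_filter.mp (mem_sqrtPoints.mp (mem_filter.mp hx).1).2).1
      rw [Nat.div_lt_iff_lt_mul hr, mul_comm Q]
      exact Nat.mul_lt_mul_of_pos_right this hQ
    · exact norm_le_supNorm β (hmR ▸ (mem_sqrtPoints.mp (mem_filter.mp hx).1).1)
    · obtain ⟨hx1, hx2⟩ := mem_filter.mp hx
      obtain ⟨hy1, hy2⟩ := mem_filter.mp hy
      have hxm := (hMmem x.1).mp (mem_sqrtPoints.mp hx1).1
      have hym := (hMmem y.1).mp (mem_sqrtPoints.mp hy1).1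
      have h1 := abs_sub_le_of_derivWithin_le hf hf' (x := x.1) (y := y.1)
        ⟨by exact_mod_cast hxm.1, hxm.2⟩ ⟨by exact_mod_cast hym.1, hym.2⟩
      have h2 : |(x.1 : ℝ) - y.1| ≤ H := by
        have e1 := Nat.div_add_mod x.1 H
        have e2 := Nat.div_add_mod y.1 H
        rw [hx2] at e1
        rw [hy2] at e2
        have l1 := Nat.mod_lt x.1 hH
        have l2 := Nat.mod_lt y.1 hH
        have : |(x.1 : ℤ) - y.1| ≤ H := by
          generalize H * b = c at e1 e2
          rw [abs_le]
          constructor <;> omega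
        exact_mod_cast this
      have h3 := abs_div_sub_div_sub_le r Q x.2 y.2 hr hQ
      have h4 : |f x.1 - f y.1| ≤ 1 / Q := h1.trans ((mul_le_mul_of_nonneg_left h2 hF).trans hHF')
      have e : (x.2 : ℝ) / r + f x.1 - ((y.2 : ℝ) / r + f y.1) -
          (((x.2 * Q / r : ℕ) : ℝ) - (y.2 * Q / r : ℕ)) / Q =
          ((x.2 : ℝ) / r - y.2 / r - (((x.2 * Q / r : ℕ) : ℝ) - (y.2 * Q / r : ℕ)) / Q) +
            (f x.1 - f y.1) := by ring
      calc _ = |((x.2 : ℝ) / r - y.2 / r - (((x.2 * Q / r : ℕ) : ℝ) - (y.2 * Q / r : ℕ)) / Q) +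
            (f x.1 - f y.1)| := by rw [← e]
        _ ≤ 1 / Q + 1 / Q := (abs_add_le _ _).trans (add_le_add h3 h4)
        _ = 2 / Q := by ring
  have hcount : ((M' / H + 1 : ℕ) : ℝ) ≤ 2 * M' / H := by
    have hH0 : (0 : ℝ) < H := by exact_mod_cast hH
    have h1 : ((M' / H : ℕ) : ℝ) ≤ (M' : ℝ) / H := Nat.cast_div_le
    have h2 : (1 : ℝ) ≤ M' / H := by
      rw [le_div_iff₀ hH0, one_mul]
      exact_mod_cast hHM'
    push_cast at h1 ⊢
    rw [mul_div_assoc]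
    linarith
  -- Cauchy–Schwarz over the at most `2M' / H` blocks.
  have hsplit : ∀ l : ℤ,
      ‖∑ x ∈ U, β x.1 * expChar (l * ((x.2 : ℝ) / r + f x.1))‖ ^ 2 ≤ 2 * M' / H *
        ∑ b ∈ range (M' / H + 1),
          ‖∑ x ∈ {x ∈ U | x.1 / H = b}, β x.1 * expChar (l * ((x.2 : ℝ) / r + f x.1))‖ ^ 2 := by
    intro l
    rw [← sum_fiberwise_of_maps_to (t := range (M' / H + 1)) (g := fun x : ℕ × ℕ => x.1 / H)
      fun x hx => mem_range.mpr (Nat.lt_succ_of_le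
        (Nat.div_le_div_right (mem_Icc.mp (mem_sqrtPoints.mp hx).1).2))]
    refine (pow_le_pow_left₀ (norm_nonneg _) (norm_sum_le _ _) 2).trans
      (sq_sum_le_card_mul_sum_sq.trans ?_)
    rw [card_range]
    gcongr
  have hcell : ∑ b ∈ range (M' / H + 1), ∑ i ∈ range Q,
      (#{x ∈ {x ∈ U | x.1 / H = b} | x.2 * Q / r = i} : ℝ) ^ 2 ≤ #(closePairs r j M' H (r / Q)) := by
    exact_mod_cast sum_card_cell_sq_le r j M' H Q hH hQ
  rw [hLR]
  calc _ ≤ ∑ l ∈ Icc (-Q : ℤ) Q, 2 * M' / H * ∑ b ∈ range (M' / H + 1),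
        ‖∑ x ∈ {x ∈ U | x.1 / H = b}, β x.1 * expChar (l * ((x.2 : ℝ) / r + f x.1))‖ ^ 2 :=
        sum_le_sum fun l _ => hsplit l
    _ = 2 * M' / H * ∑ b ∈ range (M' / H + 1), ∑ l ∈ Icc (-Q : ℤ) Q,
        ‖∑ x ∈ {x ∈ U | x.1 / H = b}, β x.1 * expChar (l * ((x.2 : ℝ) / r + f x.1))‖ ^ 2 := by
        rw [← mul_sum, sum_comm]
    _ ≤ 2 * M' / H * ∑ b ∈ range (M' / H + 1), B ^ 2 * (48 * Q * ∑ i ∈ Icc 1 Q, (i : ℝ)⁻¹) *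
          ∑ i ∈ range Q, (#{x ∈ {x ∈ U | x.1 / H = b} | x.2 * Q / r = i} : ℝ) ^ 2 :=
        mul_le_mul_of_nonneg_left (sum_le_sum hblock) (by positivity)
    _ = 2 * M' / H * (B ^ 2 * (48 * Q * ∑ i ∈ Icc 1 Q, (i : ℝ)⁻¹)) *
        ∑ b ∈ range (M' / H + 1), ∑ i ∈ range Q,
          (#{x ∈ {x ∈ U | x.1 / H = b} | x.2 * Q / r = i} : ℝ) ^ 2 := by
        rw [← mul_sum]; ring
    _ ≤ _ := mul_le_mul_of_nonneg_left hcell (by positivity)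

/-! ### Conclusion -/

/-- The three terms of the bound, as fourth powers. -/
lemma sum_le_pow_four (H L M r : ℝ) (hH : 0 < H) (hL : 0 < L) (hM : 0 < M) (hr : 0 < r) :
    M ^ 4 * L ^ 2 / H ^ 2 + H * M ^ 4 * L + M ^ 3 * L * r / H ≤
      (H ^ (-(1 / 2) : ℝ) * L ^ (1 / 2 : ℝ) * M + H ^ (1 / 4 : ℝ) * L ^ (1 / 4 : ℝ) * M
        + H ^ (-(1 / 4) : ℝ) * L ^ (1 / 4 : ℝ) * M ^ (3 / 4 : ℝ) * r ^ (1 / 4 : ℝ)) ^ 4 := by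
  have hp : ∀ x : ℝ, 0 < x → ∀ s : ℝ, (x ^ s) ^ 4 = x ^ (s * 4) := fun x hx s => by
    rw [← Real.rpow_natCast, ← Real.rpow_mul hx.le]
    norm_num
  set a := H ^ (-(1 / 2) : ℝ) * L ^ (1 / 2 : ℝ) * M with ha
  set b := H ^ (1 / 4 : ℝ) * L ^ (1 / 4 : ℝ) * M with hb
  set c := H ^ (-(1 / 4) : ℝ) * L ^ (1 / 4 : ℝ) * M ^ (3 / 4 : ℝ) * r ^ (1 / 4 : ℝ) with hc
  have ha0 : 0 < a := by positivity
  have hb0 : 0 < b := by positivity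
  have hc0 : 0 < c := by positivity
  have e1 : a ^ 4 = M ^ 4 * L ^ 2 / H ^ 2 := by
    rw [ha, mul_pow, mul_pow, hp H hH, hp L hL]
    norm_num
    field_simp
  have e2 : b ^ 4 = H * M ^ 4 * L := by
    rw [hb, mul_pow, mul_pow, hp H hH, hp L hL]
    norm_num
    ring
  have e3 : c ^ 4 = M ^ 3 * L * r / H := by
    rw [hc, mul_pow, mul_pow, mul_pow, hp H hH, hp L hL, hp M hM, hp r hr]
    norm_num
    rw [Real.rpow_neg hH.le, Real.rpow_one]
    field_simp
  rw [← e1, ← e2, ← e3]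
  have h1 : a ^ 4 + b ^ 4 ≤ (a + b) ^ 4 := pow_add_pow_le ha0.le hb0.le four_ne_zero
  have h2 : (a + b) ^ 4 + c ^ 4 ≤ (a + b + c) ^ 4 :=
    pow_add_pow_le (by positivity) hc0.le four_ne_zero
  linarith

/-- The condition `H ≤ 1 / (L F)` is written `H * (L * F) ≤ 1`, so that it is void for `F = 0`. -/
theorem theorem2 (ε : ℝ) (hε : 0 < ε) :
    ∃ C : ℝ, 0 < C ∧
      ∀ (r j : ℕ) (L M F : ℝ) (H : ℕ) (f : ℝ → ℝ) (α : ℤ → ℂ) (β : ℕ → ℂ),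
        0 < r → 0 < j → Nat.Coprime r j →
        1 ≤ L → L ≤ (r : ℝ) → 1 ≤ M → M ≤ (r : ℝ) →
        ContDiffOn ℝ 1 f (Set.Icc 1 M) →
        (∀ x ∈ Set.Icc 1 M, |derivWithin f (Set.Icc 1 M) x| ≤ F) →
        F ≤ 1 / L →
        1 ≤ H → (H : ℝ) * (L * F) ≤ 1 → (H : ℝ) ≤ M →
        ‖bilinearSum r j L M α β f‖ ≤
          C * ((H : ℝ) ^ (-(1 / 2) : ℝ) * L ^ (1 / 2 : ℝ) * M
              + (H : ℝ) ^ (1 / 4 : ℝ) * L ^ (1 / 4 : ℝ) * M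
              + (H : ℝ) ^ (-(1 / 4) : ℝ) * L ^ (1 / 4 : ℝ) * M ^ (3 / 4 : ℝ) * (r : ℝ) ^ (1 / 4 : ℝ))
            * l2Norm L α * supNorm M β * (r : ℝ) ^ ε := by
  -- The fourth power of the sum costs `R ^ 10`: `R ^ 8` from the close pairs and `R ^ 2` from the
  -- kernel. The exponent `2ε / 5` turns this into `(r ^ ε) ^ 4`.
  obtain ⟨C₀, hC₀, hbound⟩ := exists_divisor_harmonic_bound (2 * ε / 5) (by positivity)
  set K : ℝ := 96 ^ 2 * 22000000 * C₀ ^ 10 with hK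
  have hK1 : 1 ≤ K := by
    have : 1 ≤ C₀ ^ 10 := one_le_pow₀ hC₀
    linarith
  refine ⟨K, by linarith, ?_⟩
  intro r j L M F H f α β hr _ hj hL hLr hM hMr hf hf' _ hH hHF hHM
  obtain ⟨hR, hharm⟩ := hbound r hr
  set R : ℝ := C₀ * (r : ℝ) ^ (2 * ε / 5) with hRdef
  set T : ℝ := (H : ℝ) ^ (-(1 / 2) : ℝ) * L ^ (1 / 2 : ℝ) * M
    + (H : ℝ) ^ (1 / 4 : ℝ) * L ^ (1 / 4 : ℝ) * M
    + (H : ℝ) ^ (-(1 / 4) : ℝ) * L ^ (1 / 4 : ℝ) * M ^ (3 / 4 : ℝ) * (r : ℝ) ^ (1 / 4 : ℝ) with hT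
  have hr' : (0 : ℝ) < r := by exact_mod_cast hr
  have hH' : (0 : ℝ) < H := by exact_mod_cast hH
  have hL0 : 0 < L := by linarith
  have hM0 : 0 < M := by linarith
  have hT0 : 0 ≤ T := by positivity
  have hα : 0 ≤ l2Norm L α := Real.sqrt_nonneg _
  have hβ : 0 ≤ supNorm M β := supNorm_nonneg M β
  have hR0 : 0 ≤ R := by positivity
  have hmean := sum_norm_sq_le_card_closePairs r j L M F H f β hr hL hM hf hf' hH hHF hHM
  set Q := ⌊L⌋₊
  set M' := ⌊M⌋₊
  have hQ0 : 0 < Q := Nat.floor_pos.mpr hL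
  have hQ : (0 : ℝ) < Q := by exact_mod_cast hQ0
  have hQL : (Q : ℝ) ≤ L := Nat.floor_le hL0.le
  have hM'M : (M' : ℝ) ≤ M := Nat.floor_le hM0.le
  have hQr : Q ≤ r := by exact_mod_cast hQL.trans hLr
  have hM'r : M' ≤ r := by exact_mod_cast hM'M.trans hMr
  have hpairs := card_closePairs_sq_le (A := r / Q) hr hj hM'r hH (Nat.le_floor hHM)
    (Nat.div_le_self r Q) hR hharm
  set N : ℝ := (#(closePairs r j M' H (r / Q)) : ℝ)
  have hN0 : 0 ≤ N := Nat.cast_nonneg _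
  set A : ℕ := r / Q
  have hQA : (Q : ℝ) * A ≤ r := by
    have h : Q * A ≤ r := Nat.mul_div_le r Q
    exact_mod_cast h
  -- With `A = r / Q` and `QA ≤ r`, the three terms of the pair count become the fourth powers of
  -- the three terms of `T`.
  have hfour : (M' / H * (Q * N)) ^ 2 ≤ 22000000 * R ^ 8 * T ^ 4 := by
    have h1 : (M' / H * (Q * N)) ^ 2 = (M' / H * Q) ^ 2 * N ^ 2 := by ring
    have hAr : (Q : ℝ) * (A / r) ≤ 1 := by
      rw [← mul_div_assoc]
      exact (div_le_one hr').mpr hQA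
    rw [h1]
    calc (M' / H * Q : ℝ) ^ 2 * N ^ 2 ≤ (M' / H * Q) ^ 2 *
          (22000000 * R ^ 8 * (M' ^ 2 + H ^ 3 * M' ^ 2 * A / r + H * M' * A)) := by gcongr
      _ = 22000000 * R ^ 8 * ((M' : ℝ) ^ 4 * Q ^ 2 / H ^ 2 + H * M' ^ 4 * Q * (Q * (A / r)) +
          M' ^ 3 * Q * (Q * A) / H) := by field_simp
      _ ≤ 22000000 * R ^ 8 * (M ^ 4 * L ^ 2 / H ^ 2 + H * M ^ 4 * L * 1 + M ^ 3 * L * r / H) := by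
          gcongr
      _ ≤ 22000000 * R ^ 8 * T ^ 4 := by
          rw [mul_one]
          gcongr
          exact sum_le_pow_four H L M r hH' hL0 hM0 hr'
  have hCS : ‖bilinearSum r j L M α β f‖ ^ 2 ≤
      l2Norm L α ^ 2 * (96 * supNorm M β ^ 2 * R * (M' / H * (Q * N))) := by
    rw [bilinearSum_eq]
    have h1 : ‖∑ l ∈ lRange L, α l *
        ∑ x ∈ sqrtPoints r j M', β x.1 * expChar (l * ((x.2 : ℝ) / r + f x.1))‖ ≤
        ∑ l ∈ lRange L, ‖α l‖ *
          ‖∑ x ∈ sqrtPoints r j M', β x.1 * expChar (l * ((x.2 : ℝ) / r + f x.1))‖ :=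
      (norm_sum_le _ _).trans (sum_le_sum fun l _ => (norm_mul _ _).le)
    refine (pow_le_pow_left₀ (norm_nonneg _) h1 2).trans
      ((sum_mul_sq_le_sq_mul_sq _ _ _).trans ?_)
    rw [l2Norm, Real.sq_sqrt (sum_nonneg fun _ _ => by positivity)]
    refine mul_le_mul_of_nonneg_left (hmean.trans ?_) (sum_nonneg fun _ _ => by positivity)
    have h2 := hharm Q (hQr.trans (Nat.le_self_pow two_ne_zero r))
    calc _ ≤ 2 * M' / H * (supNorm M β ^ 2 * (48 * Q * R)) * N := by gcongr
      _ = _ := by ring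
  have hR10 : R ^ 10 = C₀ ^ 10 * ((r : ℝ) ^ ε) ^ 4 := by
    rw [hRdef, mul_pow, ← Real.rpow_natCast ((r : ℝ) ^ (2 * ε / 5)),
      ← Real.rpow_natCast ((r : ℝ) ^ ε), ← Real.rpow_mul hr'.le, ← Real.rpow_mul hr'.le]
    congr 2
    push_cast
    ring
  refine le_of_pow_le_pow_left₀ four_ne_zero (by positivity) ?_
  calc ‖bilinearSum r j L M α β f‖ ^ 4 = (‖bilinearSum r j L M α β f‖ ^ 2) ^ 2 := by ring
    _ ≤ (l2Norm L α ^ 2 * (96 * supNorm M β ^ 2 * R * (M' / H * (Q * N)))) ^ 2 :=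
        pow_le_pow_left₀ (by positivity) hCS 2
    _ = l2Norm L α ^ 4 * 96 ^ 2 * supNorm M β ^ 4 * R ^ 2 * (M' / H * (Q * N)) ^ 2 := by ring
    _ ≤ l2Norm L α ^ 4 * 96 ^ 2 * supNorm M β ^ 4 * R ^ 2 * (22000000 * R ^ 8 * T ^ 4) := by gcongr
    _ = (96 ^ 2 * 22000000) * R ^ 10 * (T * l2Norm L α * supNorm M β) ^ 4 := by ring
    _ = K * (T * l2Norm L α * supNorm M β * (r : ℝ) ^ ε) ^ 4 := by rw [hR10, hK]; ring
    _ ≤ K ^ 4 * (T * l2Norm L α * supNorm M β * (r : ℝ) ^ ε) ^ 4 := by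
        gcongr
        exact le_self_pow₀ hK1 four_ne_zero
    _ = _ := by ring
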